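/- Let $n>1$ be an odd integer and let $p$ be a prime with $p\equiv 1\pmod n$. Let $\zeta_p$ be a primitive $p$-th root of unity, let $r$ be a primitive root modulo $p$, let $\sigma$ be the automorphism of $\mathbb{Q}(\zeta_p)$ with $\sigma(\zeta_p)=\zeta_p^{r}$, and let $\lambda$ be an integer with $\lambda(r-1)\equiv 1\pmod p$. Let $\mathbb{K}=\{y\in\mathbb{Q}(\zeta_p):\sigma^n(y)=y\}$, a totally real number field of degree $n$ with ring of integers $\mathcal{O}_{\mathbb{K}}$, and put $$\alpha=\prod_{j=0}^{(p-1)/2-1}\bigl(1-\zeta_p^{r^j}\bigr),\qquad z=\zeta_p^{\lambda}\,\alpha\,(1-\zeta_p),\qquad x=\mathrm{Tr}_{\mathbb{Q}(\zeta_p)/\mathbb{K}}(z)\in\mathbb{K}.$$ Let $M\subset\mathbb{K}$ be the $\mathbb{Z}$-module generated by $$x+\sigma(x),\quad x-\sigma(x),\quad \sigma(x)-\sigma^2(x),\ \ldots,\ \sigma^{n-2}(x)-\sigma^{n-1}(x).$$ For a totally positive $\beta\in\mathbb{K}$ let $\varphi_\beta:\mathbb{K}\to\mathbb{R}^n$ be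 given by $\varphi_\beta(y)=\bigl(\sqrt{\sigma_i(\beta)}\,\sigma_i(y)\bigr)_{i=1}^{n}$, where $\sigma_1,\dots,\sigma_n$ are the embeddings of $\mathbb{K}$ into $\mathbb{R}$. Let $D_n$ be the lattice of vectors in $\mathbb{Z}^n$ with even coordinate sum. Suppose that $u=\sigma(x)/x$ belongs to $\mathbb{Z}[\zeta_p]$ and that $1+u$ or $1-u$ is a unit of $\mathcal{O}_{\mathbb{K}}$. Then $\Lambda=\varphi_{1/p^2}(M)$ is a rotated version of $D_n$ (the image of $D_n$ under a linear isometry of $\mathbb{R}^n$), it has maximum diversity (every nonzero vector of $\Lambda$ has all its coordinates nonzero), and its minimum product distance is $$d_{p,\min}(\Lambda)=\inf\bigl\{|v_1\cdots v_n| : 0\neq v=(v_1,\dots,v_n)\in\Lambda\bigr\}=p^{\frac{1-n}{2}}.$$ -/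

import Mathlib

open scoped NumberField

noncomputable section

namespace RotatedDn

section Lattices

/-- The lattice `D_n`: the integer vectors of `ℝⁿ` whose coordinates have an even sum. -/
def latticeD (n : ℕ) : AddSubgroup (EuclideanSpace ℝ (Fin n)) where
  carrier := {v | ∃ a : Fin n → ℤ, (∀ i, v i = (a i : ℝ)) ∧ ∃ m : ℤ, ∑ i, a i = 2 * m}
  zero_mem' := ⟨0, by simp, 0, by simp⟩
  add_mem' := by
    rintro v w ⟨a, ha, m, hm⟩ ⟨b, hb, k, hk⟩
    refine ⟨a + b, fun i => by simp [ha, hb], m + k, ?_⟩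
    simp only [Pi.add_apply, Finset.sum_add_distrib, hm, hk]
    ring
  neg_mem' := by
    rintro v ⟨a, ha, m, hm⟩
    refine ⟨-a, fun i => by simp [ha], -m, ?_⟩
    simp only [Pi.neg_apply, Finset.sum_neg_distrib, hm]
    ring

/-- `Λ` is a rotated version of `Λ'`: some linear isometry carries `Λ'` onto `Λ`. -/
def IsRotatedVersion {ι κ : Type*} [Fintype ι] [Fintype κ]
    (Λ : AddSubgroup (EuclideanSpace ℝ ι)) (Λ' : AddSubgroup (EuclideanSpace ℝ κ)) : Prop :=
  ∃ f : EuclideanSpace ℝ κ ≃ₗᵢ[ℝ] EuclideanSpace ℝ ι,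
    f '' (Λ' : Set (EuclideanSpace ℝ κ)) = (Λ : Set (EuclideanSpace ℝ ι))

/-- Every nonzero vector of `Λ` has all its coordinates nonzero. -/
def HasMaximumDiversity {ι : Type*} [Fintype ι] (Λ : AddSubgroup (EuclideanSpace ℝ ι)) : Prop :=
  ∀ v ∈ Λ, v ≠ 0 → ∀ i, v i ≠ 0

/-- The minimum product distance of `Λ` (meant for `Λ` of maximum diversity). -/
def minProductDistance {ι : Type*} [Fintype ι] (Λ : AddSubgroup (EuclideanSpace ℝ ι)) : ℝ :=
  sInf {d : ℝ | ∃ v ∈ Λ, v ≠ 0 ∧ d = |∏ i, v i|}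

/-- The twisted homomorphism `y ↦ (√(τ β) · τ y)_τ`, where `τ` runs over the embeddings of `F`
into `ℝ` (for `F` a totally real number field and `β` totally positive). The coordinates are
indexed by the embeddings themselves instead of by a numbering of them. -/
def twistedHom (F : Type*) [Field F] [NumberField F] (β : F) :
    F →+ EuclideanSpace ℝ (F →+* ℝ) where
  toFun y := WithLp.toLp 2 fun τ => Real.sqrt (τ β) * τ y
  map_zero' := by ext τ; simp
  map_add' y w := by ext τ; simp [mul_add]

end Lattices

section Construction

variable {L : Type*} [Field L] [NumberField L]

/-- The field `K = {y : σⁿ y = y}`, the fixed field of the subgroup generated by `σⁿ`. -/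
abbrev fixedK (σ : L ≃ₐ[ℚ] L) (n : ℕ) : IntermediateField ℚ L :=
  IntermediateField.fixedField (Subgroup.zpowers (σ ^ n))

theorem mem_fixedK_iff (σ : L ≃ₐ[ℚ] L) (n : ℕ) (y : L) :
    y ∈ fixedK σ n ↔ (σ ^ n) y = y := by
  rw [IntermediateField.mem_fixedField_iff]
  refine ⟨fun h => h _ (Subgroup.mem_zpowers _), fun h f hf => ?_⟩
  have hle : Subgroup.zpowers (σ ^ n) ≤ MulAction.stabilizer (L ≃ₐ[ℚ] L) y := by
    rw [Subgroup.zpowers_le]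
    exact h
  exact hle hf

theorem map_mem_fixedK (σ : L ≃ₐ[ℚ] L) (n : ℕ) {y : L} (hy : y ∈ fixedK σ n) :
    σ y ∈ fixedK σ n := by
  rw [mem_fixedK_iff] at hy ⊢
  rw [← AlgEquiv.mul_apply, ← pow_succ, pow_succ', AlgEquiv.mul_apply, hy]

/-- The restriction of `σ` to `K`. -/
def sigmaK (σ : L ≃ₐ[ℚ] L) (n : ℕ) : fixedK σ n →ₐ[ℚ] fixedK σ n :=
  (σ.toAlgHom.comp (fixedK σ n).val).codRestrict (fixedK σ n).toSubalgebra
    fun y => map_mem_fixedK σ n y.2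

theorem coe_sigmaK (σ : L ≃ₐ[ℚ] L) (n : ℕ) (y : fixedK σ n) :
    ((sigmaK σ n y : fixedK σ n) : L) = σ (y : L) := rfl

/-- `α = ∏_{j < (p-1)/2} (1 - ζ^(r^j))`. -/
def alpha (p r : ℕ) (ζ : L) : L :=
  ∏ j ∈ Finset.range ((p - 1) / 2), (1 - ζ ^ (r ^ j))

/-- `z = ζ^ℓ · α · (1 - ζ)`. -/
def zElt (p r : ℕ) (ℓ : ℤ) (ζ : L) : L :=
  ζ ^ ℓ * alpha p r ζ * (1 - ζ)

/-- `x = Tr_{L/K}(z)`. -/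
def xElt (σ : L ≃ₐ[ℚ] L) (n p r : ℕ) (ℓ : ℤ) (ζ : L) : fixedK σ n :=
  Algebra.trace (fixedK σ n) L (zElt p r ℓ ζ)

/-- The `ℤ`-module generated by `x + σ x` and `σ^i x - σ^(i+1) x` for `0 ≤ i ≤ n - 2`. -/
def moduleM (σ : L ≃ₐ[ℚ] L) (n : ℕ) (x : fixedK σ n) : AddSubgroup (fixedK σ n) :=
  AddSubgroup.closure
    ({x + sigmaK σ n x} ∪
      {y | ∃ i < n - 1, y = (sigmaK σ n ^ i) x - (sigmaK σ n ^ (i + 1)) x})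

/-- The algebraic lattice `φ_β(M)` with `β = 1/p²`. -/
def rotatedLattice (σ : L ≃ₐ[ℚ] L) (n p : ℕ) (x : fixedK σ n) :
    AddSubgroup (EuclideanSpace ℝ (fixedK σ n →+* ℝ)) :=
  (moduleM σ n x).map (twistedHom (fixedK σ n) (1 / (p : fixedK σ n) ^ 2))

end Construction

end RotatedDn

end

/-! Write `p - 1 = 2nq` and `β = ζ^ℓ α`. Then `σ β = -β` and `β² = ± p`, so `σ^s z = (-1)^s β (1 -
ζ^(r^s))`, and the trace of `z · σ^s z` from `L` to `ℚ` is a sum of powers of `ζ`. It equals `± p²`,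
with an extra `± p²` only for `s ≡ nq`. Summing over `s = nc + t` gives the trace of `x · σ^t x`
from `K` to `ℚ`: as `n` is odd the common terms alternate and cancel, leaving `p²` for `t = 0` and
`0` for `0 < t < n` (`orbitSum_conj_mul_conj`). So the vectors `φ(σ^i x)` form an orthonormal basis,
and the generators of `M` become the usual generators of `D_n`.

The product of the coordinates of `φ(y)` is `N(y) / p^n`, where `N` is the norm from `K` to `ℚ`. Put
`k = (n+1)/2`. Lower bound: each `y ∈ M` is divisible by `β (1 - ζ)`, so `y² / p` is an integer of
`K` divisible by `1 - ζ`. Hence `p^(n+1)` divides `N(y)²`, and `p^k` divides `N(y)`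
(`pow_dvd_of_orbitProd_eq`).

Attainment: `x (1 ± u) = x ± σ x` lies in `M`, so for a unit `1 ± u` it is enough that `N(x) = ±
p^k`. By orthogonality the conjugates of `x` generate over `ℤ` every element of `K` divisible by `β`
(`exists_eq_sum_conj`). One such element `w` has norm `p^k` (`exists_orbitProd_eq_pow`). Integrality
of `u` makes `w / x` integral, so `N(x)` divides `p^k`, while `p^k` divides `N(x)`
(`orbitProd_xElt`). -/

namespace RotatedDn

/-! ### Sums and products over the primitive `p`-th roots of unity -/

section PrimitiveRoots

theorem pow_eq_pow_iff_of_isPrimitiveRoot {L : Type*} [Field L] {p : ℕ} (hp : p.Prime) {ζ : L}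
    (hζ : IsPrimitiveRoot ζ p) (a b : ℕ) : ζ ^ a = ζ ^ b ↔ ((a : ZMod p) = b) := by
  rw [ZMod.natCast_eq_natCast_iff]
  have key : ∀ c, ζ ^ c = ζ ^ (c % p) := fun c => by
    conv_lhs => rw [← Nat.div_add_mod c p, pow_add, pow_mul, hζ.pow_eq_one, one_pow, one_mul]
  constructor
  · intro h
    rw [key a, key b] at h
    exact hζ.pow_inj (Nat.mod_lt _ hp.pos) (Nat.mod_lt _ hp.pos) h
  · intro h
    rw [key a, key b, h]

/-- By counting, `p - 1` distinct nonzero exponents modulo `p` reach every primitive root. Using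
this for both `r^b` and `b + 1` turns orbits of `σ` into ordinary geometric ranges. -/
theorem prod_pow_eq_prod_primitiveRoots {L M : Type*} [Field L] [CommMonoid M] {p : ℕ}
    (hp : p.Prime) {ζ : L} (hζ : IsPrimitiveRoot ζ p) (d : ℕ → ℕ)
    (hd : ∀ b < p - 1, (d b : ZMod p) ≠ 0)
    (hinj : ∀ a < p - 1, ∀ b < p - 1, (d a : ZMod p) = d b → a = b) (f : L → M) :
    ∏ b ∈ Finset.range (p - 1), f (ζ ^ d b) = ∏ μ ∈ primitiveRoots p L, f μ := by
  have hmaps : Set.MapsTo (fun b => ζ ^ d b) (Finset.range (p - 1) : Set ℕ)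
      (primitiveRoots p L : Set L) := by
    intro b hb
    have hb' : b < p - 1 := by simpa using hb
    refine Finset.mem_coe.2 ((mem_primitiveRoots hp.pos).2 (hζ.pow_of_coprime _ ?_))
    rw [Nat.coprime_comm, hp.coprime_iff_not_dvd, ← ZMod.natCast_eq_zero_iff]
    exact hd b hb'
  have hi : Set.InjOn (fun b => ζ ^ d b) (Finset.range (p - 1) : Set ℕ) := by
    intro a ha b hb h
    exact hinj a (by simpa using ha) b (by simpa using hb)
      ((pow_eq_pow_iff_of_isPrimitiveRoot hp hζ _ _).1 h)
  refine Finset.prod_nbij (fun b => ζ ^ d b) hmaps hi ?_ (fun _ _ => rfl)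
  refine Finset.surjOn_of_injOn_of_card_le _ hmaps hi ?_
  rw [hζ.card_primitiveRoots, Nat.totient_prime hp, Finset.card_range]

variable {L : Type*} [Field L] {p r : ℕ}

theorem natCast_ne_zero_of_orderOf (hp : p.Prime) (hr : orderOf (r : ZMod p) = p - 1) :
    (r : ZMod p) ≠ 0 := by
  have := Fact.mk hp
  intro h
  rw [h] at hr
  have h1 : (0 : ZMod p) ^ (p - 1) = 1 := by rw [← hr]; exact pow_orderOf_eq_one _
  have : p - 1 ≠ 0 := by have := hp.two_le; omega
  rw [zero_pow this] at h1
  exact zero_ne_one h1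

theorem pow_natCast_eq_iff (hp : p.Prime) (hr : orderOf (r : ZMod p) = p - 1) (a b : ℕ) :
    (r : ZMod p) ^ a = (r : ZMod p) ^ b ↔ a ≡ b [MOD (p - 1)] := by
  have := Fact.mk hp
  have h0 := natCast_ne_zero_of_orderOf hp hr
  have := pow_eq_pow_iff_modEq (x := Units.mk0 (r : ZMod p) h0) (n := a) (m := b)
  rw [← orderOf_units, Units.val_mk0, hr] at this
  rw [← this, ← Units.val_inj]
  simp

theorem prod_pow_pow_eq_prod_primitiveRoots {M : Type*} [CommMonoid M] (hp : p.Prime)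
    (hr : orderOf (r : ZMod p) = p - 1) {ζ : L} (hζ : IsPrimitiveRoot ζ p) (f : L → M) :
    ∏ b ∈ Finset.range (p - 1), f (ζ ^ r ^ b) = ∏ μ ∈ primitiveRoots p L, f μ := by
  have := Fact.mk hp
  refine prod_pow_eq_prod_primitiveRoots hp hζ (fun b => r ^ b) ?_ ?_ f
  · intro b _
    push_cast
    exact pow_ne_zero _ (natCast_ne_zero_of_orderOf hp hr)
  · intro a ha b hb h
    push_cast at h
    exact Nat.ModEq.eq_of_lt_of_lt ((pow_natCast_eq_iff hp hr a b).1 h) ha hb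

theorem prod_succ_pow_eq_prod_primitiveRoots {M : Type*} [CommMonoid M] (hp : p.Prime)
    {ζ : L} (hζ : IsPrimitiveRoot ζ p) (f : L → M) :
    ∏ b ∈ Finset.range (p - 1), f (ζ ^ (b + 1)) = ∏ μ ∈ primitiveRoots p L, f μ := by
  refine prod_pow_eq_prod_primitiveRoots hp hζ (fun b => b + 1) ?_ ?_ f
  · intro b hb h
    rw [ZMod.natCast_eq_zero_iff] at h
    have := Nat.le_of_dvd (by omega) h
    omega
  · intro a ha b hb h
    rw [ZMod.natCast_eq_natCast_iff] at h
    have := Nat.ModEq.eq_of_lt_of_lt h (by omega) (by omega)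
    omega

theorem prod_one_sub_pow_pow (hp : p.Prime) (hr : orderOf (r : ZMod p) = p - 1) {ζ : L}
    (hζ : IsPrimitiveRoot ζ p) : ∏ b ∈ Finset.range (p - 1), (1 - ζ ^ r ^ b) = p := by
  rw [prod_pow_pow_eq_prod_primitiveRoots hp hr hζ (fun μ => 1 - μ),
    ← prod_succ_pow_eq_prod_primitiveRoots hp hζ]
  obtain ⟨q, rfl⟩ : ∃ q, p = q + 1 := ⟨p - 1, by have := hp.pos; omega⟩
  simpa using hζ.prod_one_sub_pow_eq_order

theorem sum_pow_pow (hp : p.Prime) (hr : orderOf (r : ZMod p) = p - 1) {ζ : L}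
    (hζ : IsPrimitiveRoot ζ p) : ∑ b ∈ Finset.range (p - 1), ζ ^ r ^ b = -1 := by
  -- Taking values in `Multiplicative L` makes the product formula a statement about sums.
  have h1 := prod_pow_pow_eq_prod_primitiveRoots hp hr hζ (fun μ => Multiplicative.ofAdd μ)
  rw [← prod_succ_pow_eq_prod_primitiveRoots hp hζ] at h1
  have h2 : ∑ b ∈ Finset.range (p - 1), ζ ^ r ^ b = ∑ b ∈ Finset.range (p - 1), ζ ^ (b + 1) := h1
  rw [h2]
  have h3 := hζ.geom_sum_eq_zero hp.one_lt
  obtain ⟨q, rfl⟩ : ∃ q, p = q + 1 := ⟨p - 1, by have := hp.pos; omega⟩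
  rw [Finset.sum_range_succ'] at h3
  simp only [pow_zero] at h3
  simpa using eq_neg_of_add_eq_zero_left h3

theorem sum_pow_mul_pow (hp : p.Prime) (hr : orderOf (r : ZMod p) = p - 1) {ζ : L}
    (hζ : IsPrimitiveRoot ζ p) (k : ℕ) :
    ∑ b ∈ Finset.range (p - 1), (ζ ^ k) ^ r ^ b = (if (k : ZMod p) = 0 then (p : L) else 0) - 1 := by
  split_ifs with h
  · rw [ZMod.natCast_eq_zero_iff] at h
    have : ζ ^ k = 1 := (hζ.pow_eq_one_iff_dvd k).2 h
    simp [this, Nat.cast_sub hp.one_lt.le]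
  · rw [zero_sub]
    refine sum_pow_pow hp hr (hζ.pow_of_coprime _ ?_)
    rwa [Nat.coprime_comm, hp.coprime_iff_not_dvd, ← ZMod.natCast_eq_zero_iff]

theorem pow_half_eq_neg_one (hp : p.Prime) (hp2 : p ≠ 2) (hr : orderOf (r : ZMod p) = p - 1) :
    (r : ZMod p) ^ ((p - 1) / 2) = -1 := by
  have := Fact.mk hp
  have hev : 2 * ((p - 1) / 2) = p - 1 := by
    have := hp.eq_two_or_odd
    omega
  have h1 : ((r : ZMod p) ^ ((p - 1) / 2)) ^ 2 = 1 := by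
    rw [← pow_mul, mul_comm, hev, ← hr, pow_orderOf_eq_one]
  rcases sq_eq_one_iff.1 h1 with h | h
  · exfalso
    have := (pow_natCast_eq_iff hp hr ((p - 1) / 2) 0).1 (by simpa using h)
    have h3 := hp.two_le
    have := this.eq_of_lt_of_lt (by omega) (by omega)
    omega
  · exact h

end PrimitiveRoots

/-! ### Splitting an index as `n * c + i` -/

section RangeMul

theorem prod_range_mul {M : Type*} [CommMonoid M] (f : ℕ → M) (n m : ℕ) :
    ∏ b ∈ Finset.range (n * m), f b =
      ∏ c ∈ Finset.range m, ∏ i ∈ Finset.range n, f (n * c + i) := by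
  induction m with
  | zero => simp
  | succ m ih => rw [Nat.mul_succ, Finset.prod_range_add, ih, Finset.prod_range_succ]

theorem sum_range_mul {M : Type*} [AddCommMonoid M] (f : ℕ → M) (n m : ℕ) :
    ∑ b ∈ Finset.range (n * m), f b =
      ∑ c ∈ Finset.range m, ∑ i ∈ Finset.range n, f (n * c + i) :=
  prod_range_mul (M := Multiplicative M) f n m

end RangeMul

end RotatedDn

namespace RotatedDn

/-! ### The cyclic Galois group, traces and norms -/

section Galois

variable {L : Type*} [Field L] [NumberField L] {p r : ℕ} {ζ : L} {σ : L ≃ₐ[ℚ] L}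

theorem pow_apply_of_apply_eq_pow (hσ : σ ζ = ζ ^ r) (k : ℕ) : (σ ^ k) ζ = ζ ^ r ^ k := by
  induction k with
  | zero => simp
  | succ k ih => rw [pow_succ', AlgEquiv.mul_apply, ih, map_pow, hσ, ← pow_mul, ← pow_succ']

theorem algHom_ext_of_isPrimitiveRoot (hp : p.Prime) [IsCyclotomicExtension {p} ℚ L]
    (hζ : IsPrimitiveRoot ζ p) {S : Type*} [Semiring S] [Algebra ℚ S] {f g : L →ₐ[ℚ] S}
    (h : f ζ = g ζ) : f = g := by
  have : NeZero p := ⟨hp.ne_zero⟩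
  exact (hζ.powerBasis ℚ).algHom_ext (by simpa using h)

theorem sigma_pow_eq_one_iff (hp : p.Prime) [IsCyclotomicExtension {p} ℚ L]
    (hζ : IsPrimitiveRoot ζ p) (hr : orderOf (r : ZMod p) = p - 1) (hσ : σ ζ = ζ ^ r) (k : ℕ) :
    σ ^ k = 1 ↔ (p - 1) ∣ k := by
  have h1 : σ ^ k = 1 ↔ (σ ^ k) ζ = ζ := by
    refine ⟨fun h => by rw [h]; rfl, fun h => ?_⟩
    have : ((σ ^ k : L ≃ₐ[ℚ] L) : L →ₐ[ℚ] L) = AlgHom.id ℚ L :=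
      algHom_ext_of_isPrimitiveRoot hp hζ (by simpa using h)
    ext y
    exact DFunLike.congr_fun this y
  rw [h1, pow_apply_of_apply_eq_pow hσ]
  have h2 := pow_eq_pow_iff_of_isPrimitiveRoot hp hζ (r ^ k) 1
  rw [pow_one] at h2
  rw [h2]
  push_cast
  rw [← hr, orderOf_dvd_iff_pow_eq_one]

theorem orderOf_sigma (hp : p.Prime) [IsCyclotomicExtension {p} ℚ L]
    (hζ : IsPrimitiveRoot ζ p) (hr : orderOf (r : ZMod p) = p - 1) (hσ : σ ζ = ζ ^ r) :
    orderOf σ = p - 1 :=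
  Nat.dvd_antisymm (orderOf_dvd_of_pow_eq_one ((sigma_pow_eq_one_iff hp hζ hr hσ _).2 dvd_rfl))
    ((sigma_pow_eq_one_iff hp hζ hr hσ _).1 (pow_orderOf_eq_one σ))

theorem exists_ratCast_of_sigma_fixed (hp : p.Prime) [IsCyclotomicExtension {p} ℚ L]
    (hζ : IsPrimitiveRoot ζ p) (hr : orderOf (r : ZMod p) = p - 1) (hσ : σ ζ = ζ ^ r) {y : L}
    (hy : σ y = y) : ∃ q : ℚ, (q : L) = y := by
  have : NeZero p := ⟨hp.ne_zero⟩
  have := IsCyclotomicExtension.isGalois {p} ℚ L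
  have hcard : Nat.card (L ≃ₐ[ℚ] L) = p - 1 := by
    rw [IsGalois.card_aut_eq_finrank, IsCyclotomicExtension.Rat.finrank p, Nat.totient_prime hp]
  have htop : Subgroup.zpowers σ = ⊤ := by
    refine Subgroup.eq_top_of_card_eq _ ?_
    rw [Nat.card_zpowers, orderOf_sigma hp hζ hr hσ, hcard]
  have hmem : y ∈ (⊥ : IntermediateField ℚ L) := by
    rw [IsGalois.mem_bot_iff_fixed]
    intro g
    have hle : Subgroup.zpowers σ ≤ MulAction.stabilizer (L ≃ₐ[ℚ] L) y := by
      rw [Subgroup.zpowers_le]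
      exact hy
    exact hle (htop ▸ Subgroup.mem_top g)
  obtain ⟨q, hq⟩ := IntermediateField.mem_bot.1 hmem
  exact ⟨q, by simpa using hq⟩

theorem exists_intCast_of_sigma_fixed (hp : p.Prime) [IsCyclotomicExtension {p} ℚ L]
    (hζ : IsPrimitiveRoot ζ p) (hr : orderOf (r : ZMod p) = p - 1) (hσ : σ ζ = ζ ^ r) {y : L}
    (hy : σ y = y) (hint : IsIntegral ℤ y) : ∃ a : ℤ, (a : L) = y := by
  obtain ⟨q, rfl⟩ := exists_ratCast_of_sigma_fixed hp hζ hr hσ hy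
  have h2 : IsIntegral ℤ q :=
    (isIntegral_algebraMap_iff (algebraMap ℚ L).injective).1 (by simpa using hint)
  obtain ⟨a, rfl⟩ := IsIntegrallyClosed.isIntegral_iff.1 h2
  exact ⟨a, by simp⟩

/-- The group of `L` over `K` is generated by `σ^n`, which has order `m`, so its elements are the
`σ^(nc)` with `c < m`. -/
theorem trace_fixedK (hp : p.Prime) [IsCyclotomicExtension {p} ℚ L]
    (hζ : IsPrimitiveRoot ζ p) (hr : orderOf (r : ZMod p) = p - 1) (hσ : σ ζ = ζ ^ r)
    {n m : ℕ} (hnm : p - 1 = n * m) (y : L) :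
    ((Algebra.trace (fixedK σ n) L y : fixedK σ n) : L) =
      ∑ c ∈ Finset.range m, (σ ^ (n * c)) y := by
  have : NeZero p := ⟨hp.ne_zero⟩
  have := IsCyclotomicExtension.isGalois {p} ℚ L
  have hn : n ≠ 0 := by
    rintro rfl
    have := hp.two_le
    omega
  have hord : orderOf (σ ^ n) = m := by
    rw [orderOf_pow_of_dvd hn (by rw [orderOf_sigma hp hζ hr hσ, hnm]; exact dvd_mul_right _ _),
      orderOf_sigma hp hζ hr hσ, hnm, Nat.mul_div_cancel_left _ (Nat.pos_of_ne_zero hn)]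
  have h1 := trace_eq_sum_automorphisms (K := fixedK σ n) y
  have h2 : ∑ g : Gal(L/fixedK σ n), g y =
      ∑ h : Subgroup.zpowers (σ ^ n), (h : L ≃ₐ[ℚ] L) y :=
    (Fintype.sum_equiv (IntermediateField.subgroupEquivAlgEquiv
      (Subgroup.zpowers (σ ^ n))).toEquiv _ _ (fun h => rfl)).symm
  have h3 : ∑ h : Subgroup.zpowers (σ ^ n), (h : L ≃ₐ[ℚ] L) y =
      ∑ c : Fin (orderOf (σ ^ n)), ((σ ^ n) ^ (c : ℕ)) y :=
    (Fintype.sum_equiv (finEquivZPowers (isOfFinOrder_of_finite _)) _ _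
      (fun h => by rw [finEquivZPowers_apply])).symm
  rw [h2, h3, Finset.sum_fin_eq_sum_range, hord] at h1
  refine h1.trans (Finset.sum_congr rfl fun c hc => ?_)
  rw [dif_pos (Finset.mem_range.1 hc), pow_mul]

theorem finrank_fixedK (hp : p.Prime) [IsCyclotomicExtension {p} ℚ L]
    (hζ : IsPrimitiveRoot ζ p) (hr : orderOf (r : ZMod p) = p - 1) (hσ : σ ζ = ζ ^ r)
    {n m : ℕ} (hnm : p - 1 = n * m) : Module.finrank ℚ (fixedK σ n) = n := by
  have : NeZero p := ⟨hp.ne_zero⟩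
  have h0 : n * m ≠ 0 := by
    have := hp.two_le
    omega
  have hn : n ≠ 0 := left_ne_zero_of_mul h0
  have hord : orderOf (σ ^ n) = m := by
    rw [orderOf_pow_of_dvd hn (by rw [orderOf_sigma hp hζ hr hσ, hnm]; exact dvd_mul_right _ _),
      orderOf_sigma hp hζ hr hσ, hnm, Nat.mul_div_cancel_left _ (Nat.pos_of_ne_zero hn)]
  have h1 := IntermediateField.finrank_fixedField_eq_card (Subgroup.zpowers (σ ^ n))
  rw [Nat.card_zpowers, hord] at h1
  have h2 := Module.finrank_mul_finrank ℚ (fixedK σ n) L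
  rw [h1, IsCyclotomicExtension.Rat.finrank p (K := L), Nat.totient_prime hp, hnm] at h2
  exact Nat.eq_of_mul_eq_mul_right (Nat.pos_of_ne_zero (right_ne_zero_of_mul h0)) h2

/-- The product of `y, σ y, …, σ^(k-1) y`. -/
def orbitProd (σ : L ≃ₐ[ℚ] L) (k : ℕ) (y : L) : L := ∏ i ∈ Finset.range k, (σ ^ i) y

/-- The sum of `y, σ y, …, σ^(k-1) y`. -/
def orbitSum (σ : L ≃ₐ[ℚ] L) (k : ℕ) (y : L) : L := ∑ i ∈ Finset.range k, (σ ^ i) y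

theorem orbitProd_mul (k : ℕ) (y w : L) :
    orbitProd σ k (y * w) = orbitProd σ k y * orbitProd σ k w := by
  simp [orbitProd, Finset.prod_mul_distrib]

theorem orbitProd_pow (k : ℕ) (y : L) (e : ℕ) :
    orbitProd σ k (y ^ e) = orbitProd σ k y ^ e := by
  simp [orbitProd, Finset.prod_pow]

theorem orbitProd_ne_zero (k : ℕ) {y : L} (hy : y ≠ 0) : orbitProd σ k y ≠ 0 :=
  Finset.prod_ne_zero_iff.2 fun i _ => (map_ne_zero (σ ^ i)).2 hy

theorem isIntegral_apply (g : L ≃ₐ[ℚ] L) {y : L} (hy : IsIntegral ℤ y) : IsIntegral ℤ (g y) :=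
  hy.map (g.toAlgHom.restrictScalars ℤ)

theorem isIntegral_orbitProd (k : ℕ) {y : L} (hy : IsIntegral ℤ y) :
    IsIntegral ℤ (orbitProd σ k y) :=
  IsIntegral.prod _ fun _ _ => isIntegral_apply _ hy

theorem isIntegral_orbitSum (k : ℕ) {y : L} (hy : IsIntegral ℤ y) :
    IsIntegral ℤ (orbitSum σ k y) :=
  IsIntegral.sum _ fun _ _ => isIntegral_apply _ hy

/-- Applying `σ` permutes the factors cyclically. Thus `orbitProd σ n` serves as the norm from `K`
to `ℚ` and `orbitProd σ (p - 1)` as the norm from `L` to `ℚ`; likewise `orbitSum` for traces. -/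
theorem sigma_orbitProd {k : ℕ} {y : L} (hy : (σ ^ k) y = y) :
    σ (orbitProd σ k y) = orbitProd σ k y := by
  have h : σ (orbitProd σ k y) = ∏ i ∈ Finset.range k, (σ ^ (i + 1)) y := by
    simp [orbitProd, pow_succ']
  rw [h]
  rcases k with _ | k
  · simp [orbitProd]
  · rw [Finset.prod_range_succ, hy, orbitProd, Finset.prod_range_succ']
    simp

theorem sigma_orbitSum {k : ℕ} {y : L} (hy : (σ ^ k) y = y) :
    σ (orbitSum σ k y) = orbitSum σ k y := by
  have h : σ (orbitSum σ k y) = ∑ i ∈ Finset.range k, (σ ^ (i + 1)) y := by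
    simp [orbitSum, pow_succ']
  rw [h]
  rcases k with _ | k
  · simp [orbitSum]
  · rw [Finset.sum_range_succ, hy, orbitSum, Finset.sum_range_succ']
    simp

theorem exists_int_orbitProd (hp : p.Prime) [IsCyclotomicExtension {p} ℚ L]
    (hζ : IsPrimitiveRoot ζ p) (hr : orderOf (r : ZMod p) = p - 1) (hσ : σ ζ = ζ ^ r)
    {k : ℕ} {y : L} (hy : (σ ^ k) y = y) (hint : IsIntegral ℤ y) :
    ∃ a : ℤ, (a : L) = orbitProd σ k y :=
  exists_intCast_of_sigma_fixed hp hζ hr hσ (sigma_orbitProd hy) (isIntegral_orbitProd k hint)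

theorem sigma_pow_sub_one (hp : p.Prime) [IsCyclotomicExtension {p} ℚ L]
    (hζ : IsPrimitiveRoot ζ p) (hr : orderOf (r : ZMod p) = p - 1) (hσ : σ ζ = ζ ^ r) (y : L) :
    (σ ^ (p - 1)) y = y := by
  rw [(sigma_pow_eq_one_iff hp hζ hr hσ _).2 dvd_rfl]
  rfl

theorem orbitProd_one_sub (hp : p.Prime) (hζ : IsPrimitiveRoot ζ p)
    (hr : orderOf (r : ZMod p) = p - 1) (hσ : σ ζ = ζ ^ r) : orbitProd σ (p - 1) (1 - ζ) = p := by
  rw [← prod_one_sub_pow_pow hp hr hζ, orbitProd]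
  simp only [map_sub, map_one, pow_apply_of_apply_eq_pow hσ]

/-- A rational integer divisible by `1 - ζ` is divisible by `p`. -/
theorem dvd_of_eq_one_sub_mul (hp : p.Prime) [IsCyclotomicExtension {p} ℚ L]
    (hζ : IsPrimitiveRoot ζ p) (hr : orderOf (r : ZMod p) = p - 1) (hσ : σ ζ = ζ ^ r)
    {a : ℤ} {b : L} (hb : IsIntegral ℤ b) (h : (a : L) = (1 - ζ) * b) : (p : ℤ) ∣ a := by
  -- With `c` the norm of `b`, taking norms gives `a^(p-1) = p c`.
  obtain ⟨c, hc⟩ := exists_int_orbitProd hp hζ hr hσ (sigma_pow_sub_one hp hζ hr hσ b) hb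
  have h1 : orbitProd σ (p - 1) (a : L) = (a : L) ^ (p - 1) := by simp [orbitProd]
  rw [h, orbitProd_mul, orbitProd_one_sub hp hζ hr hσ, ← hc, ← h] at h1
  have h2 : (p : ℤ) * c = a ^ (p - 1) := by exact_mod_cast h1
  exact (Nat.prime_iff_prime_int.1 hp).dvd_of_dvd_pow ⟨c, h2.symm⟩

end Galois

end RotatedDn

namespace RotatedDn

/-! ### The square root `β` of `± p` and the trace form on the conjugates of `x` -/

section Algebraic

variable {L : Type*} [Field L] [NumberField L]

/-- The arithmetic data of the construction, with `m = (p - 1) / n = 2 q`. -/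
structure CyclicData (p r n q : ℕ) (ℓ : ℤ) (ζ : L) (σ : L ≃ₐ[ℚ] L) : Prop where
  prime : p.Prime
  primitive : IsPrimitiveRoot ζ p
  order : orderOf (r : ZMod p) = p - 1
  apply_zeta : σ ζ = ζ ^ r
  odd : Odd n
  sub_one_eq : p - 1 = n * (2 * q)
  modEq : ℓ * ((r : ℤ) - 1) ≡ 1 [ZMOD (p : ℤ)]

/-- `β = ζ^ℓ · α`, a square root of `(-1)^((p-1)/2) p`. -/
def beta (p r : ℕ) (ℓ : ℤ) (ζ : L) : L := ζ ^ ℓ * alpha p r ζ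

theorem zElt_eq (p r : ℕ) (ℓ : ℤ) (ζ : L) : zElt p r ℓ ζ = beta p r ℓ ζ * (1 - ζ) := rfl

namespace CyclicData

variable {p r n q : ℕ} {ℓ : ℤ} {ζ : L} {σ : L ≃ₐ[ℚ] L}

theorem half_eq (D : CyclicData p r n q ℓ ζ σ) : (p - 1) / 2 = n * q := by
  rw [D.sub_one_eq, mul_left_comm, Nat.mul_div_cancel_left _ two_pos]

theorem ne_two (D : CyclicData p r n q ℓ ζ σ) : p ≠ 2 := by
  intro h
  have := D.sub_one_eq
  rw [mul_left_comm] at this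
  omega

theorem one_sub_ne_zero (D : CyclicData p r n q ℓ ζ σ) : 1 - ζ ≠ 0 :=
  sub_ne_zero.2 (D.primitive.ne_one D.prime.one_lt).symm

theorem zeta_ne_zero (D : CyclicData p r n q ℓ ζ σ) : ζ ≠ 0 :=
  D.primitive.ne_zero D.prime.ne_zero

theorem isIntegral_zeta (D : CyclicData p r n q ℓ ζ σ) : IsIntegral ℤ ζ :=
  D.primitive.isIntegral D.prime.pos

theorem isIntegral_one_sub (D : CyclicData p r n q ℓ ζ σ) : IsIntegral ℤ (1 - ζ) :=
  isIntegral_one.sub D.isIntegral_zeta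

theorem zeta_pow_half (D : CyclicData p r n q ℓ ζ σ) : ζ ^ r ^ (n * q) = ζ⁻¹ := by
  have h0 := D.zeta_ne_zero
  rw [← mul_eq_one_iff_eq_inv₀ h0, ← pow_succ, ← pow_zero ζ,
    pow_eq_pow_iff_of_isPrimitiveRoot D.prime D.primitive]
  push_cast
  rw [← D.half_eq, pow_half_eq_neg_one D.prime D.ne_two D.order]
  ring

theorem sigma_beta (D : CyclicData p r n q ℓ ζ σ) :
    σ (beta p r ℓ ζ) = -beta p r ℓ ζ := by
  have h0 := D.zeta_ne_zero
  -- Shifting `j` drops the factor `1 - ζ` and gains `1 - ζ^(r^((p-1)/2)) = 1 - ζ⁻¹`. Since `ℓ r ≡ ℓ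
  -- + 1`, the factor `ζ^ℓ` gains a `ζ`, and `ζ (1 - ζ⁻¹) = -(1 - ζ)` gives the sign.
  have h1 : σ (alpha p r ζ) * (1 - ζ) = alpha p r ζ * (1 - ζ⁻¹) := by
    have e : σ (alpha p r ζ) = ∏ j ∈ Finset.range ((p - 1) / 2), (1 - ζ ^ r ^ (j + 1)) := by
      simp only [alpha, map_prod, map_sub, map_one, map_pow, D.apply_zeta, ← pow_mul, ← pow_succ']
    have e1 := Finset.prod_range_succ (fun j => 1 - ζ ^ r ^ j) ((p - 1) / 2)
    rw [Finset.prod_range_succ', ← e] at e1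
    rw [pow_zero, pow_one] at e1
    rw [e1, alpha, ← D.zeta_pow_half, ← D.half_eq]
  have h2 : σ (ζ ^ ℓ) = ζ ^ ℓ * ζ := by
    obtain ⟨k, hk⟩ := D.modEq.symm.dvd
    rw [map_zpow₀, D.apply_zeta, ← zpow_natCast, ← zpow_mul]
    have : (r : ℤ) * ℓ = ℓ + 1 + p * k := by linear_combination hk
    rw [this, zpow_add₀ h0, zpow_add₀ h0, zpow_mul, zpow_natCast, D.primitive.pow_eq_one]
    simp
  apply mul_right_cancel₀ D.one_sub_ne_zero
  rw [beta, map_mul, h2, mul_assoc, h1]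
  field_simp
  ring

theorem sigma_pow_beta (D : CyclicData p r n q ℓ ζ σ) (s : ℕ) :
    (σ ^ s) (beta p r ℓ ζ) = (-1) ^ s * beta p r ℓ ζ := by
  induction s with
  | zero => simp
  | succ s ih =>
    rw [pow_succ', AlgEquiv.mul_apply, ih, map_mul, D.sigma_beta, map_pow, map_neg, map_one]
    ring

/-- The map `σ^(nq)` inverts `ζ` and exchanges the two halves of the product of all `1 - ζ^(r^b)`,
so `β · σ^(nq) β = p`. The sign comes from `σ β = -β`. -/
theorem beta_sq (D : CyclicData p r n q ℓ ζ σ) :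
    beta p r ℓ ζ ^ 2 = (-1) ^ (n * q) * p := by
  have h0 := D.zeta_ne_zero
  have e : (σ ^ (n * q)) (alpha p r ζ) = ∏ j ∈ Finset.range (n * q), (1 - ζ ^ r ^ (n * q + j)) := by
    simp only [alpha, map_prod, map_sub, map_one, map_pow,
      pow_apply_of_apply_eq_pow D.apply_zeta, ← pow_mul, ← pow_add, D.half_eq]
  have h1 : alpha p r ζ * (σ ^ (n * q)) (alpha p r ζ) = p := by
    rw [e, ← prod_one_sub_pow_pow D.prime D.order D.primitive, D.sub_one_eq, mul_left_comm,
      two_mul, Finset.prod_range_add, alpha, D.half_eq]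
  have h2 : (σ ^ (n * q)) (ζ ^ ℓ) = (ζ ^ ℓ)⁻¹ := by
    rw [map_zpow₀, pow_apply_of_apply_eq_pow D.apply_zeta, D.zeta_pow_half, inv_zpow]
  have h3 : beta p r ℓ ζ * (σ ^ (n * q)) (beta p r ℓ ζ) = p := by
    rw [beta, map_mul, h2, ← h1]
    have := zpow_ne_zero ℓ h0
    field_simp
  rw [D.sigma_pow_beta] at h3
  have h4 : ((-1 : L) ^ (n * q)) * (-1) ^ (n * q) = 1 := by
    rw [← mul_pow]
    simp
  linear_combination (-1) ^ (n * q) * h3 - beta p r ℓ ζ ^ 2 * h4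

theorem beta_ne_zero (D : CyclicData p r n q ℓ ζ σ) : beta p r ℓ ζ ≠ 0 := by
  intro h
  have := D.beta_sq
  rw [h, zero_pow two_ne_zero] at this
  exact mul_ne_zero (pow_ne_zero _ (neg_ne_zero.2 one_ne_zero))
    (Nat.cast_ne_zero.2 D.prime.ne_zero) this.symm

theorem isIntegral_natCast (k : ℕ) : IsIntegral ℤ (k : L) := by
  simpa using isIntegral_algebraMap (R := ℤ) (A := L) (x := (k : ℤ))

theorem isIntegral_neg_one_pow (k : ℕ) : IsIntegral ℤ ((-1 : L) ^ k) := isIntegral_one.neg.pow k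

theorem isIntegral_beta (D : CyclicData p r n q ℓ ζ σ) : IsIntegral ℤ (beta p r ℓ ζ) := by
  refine IsIntegral.of_pow two_pos ?_
  rw [D.beta_sq]
  exact (isIntegral_neg_one_pow _).mul (isIntegral_natCast _)

theorem sigma_pow_zElt (D : CyclicData p r n q ℓ ζ σ) (s : ℕ) :
    (σ ^ s) (zElt p r ℓ ζ) = (-1) ^ s * beta p r ℓ ζ * (1 - ζ ^ r ^ s) := by
  rw [zElt_eq, map_mul, D.sigma_pow_beta, map_sub, map_one, pow_apply_of_apply_eq_pow D.apply_zeta]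

theorem orbitSum_zElt_mul (D : CyclicData p r n q ℓ ζ σ) (s : ℕ) :
    orbitSum σ (p - 1) (zElt p r ℓ ζ * (σ ^ s) (zElt p r ℓ ζ)) =
      (-1) ^ s * (-1) ^ (n * q) * p ^ 2 *
        (1 + if s ≡ n * q [MOD (p - 1)] then 1 else 0) := by
  have h1 : zElt p r ℓ ζ * (σ ^ s) (zElt p r ℓ ζ) =
      (((-1) ^ s * (-1) ^ (n * q) * p : ℤ) : L) * (1 - ζ - ζ ^ r ^ s + ζ ^ (1 + r ^ s)) := by
    rw [D.sigma_pow_zElt, zElt_eq]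
    push_cast
    rw [pow_add]
    linear_combination (-1) ^ s * (1 - ζ) * (1 - ζ ^ r ^ s) * D.beta_sq
  have h2 : ∀ b, (σ ^ b) (zElt p r ℓ ζ * (σ ^ s) (zElt p r ℓ ζ)) =
      (((-1) ^ s * (-1) ^ (n * q) * p : ℤ) : L) *
        (1 - (ζ ^ 1) ^ r ^ b - (ζ ^ r ^ s) ^ r ^ b + (ζ ^ (1 + r ^ s)) ^ r ^ b) := by
    intro b
    rw [h1, map_mul, map_intCast, map_add, map_sub, map_sub, map_one, map_pow, map_pow,
      pow_apply_of_apply_eq_pow D.apply_zeta, pow_one, pow_right_comm, pow_right_comm ζ (r ^ b)]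
  have hp1 : 1 ≤ p := D.prime.one_lt.le
  have : Fact p.Prime := ⟨D.prime⟩
  have hs : ((r ^ s : ℕ) : ZMod p) ≠ 0 := by
    push_cast
    exact pow_ne_zero _ (natCast_ne_zero_of_orderOf D.prime D.order)
  have hs1 : ((1 : ℕ) : ZMod p) ≠ 0 := by simp
  have hs2 : ((1 + r ^ s : ℕ) : ZMod p) = 0 ↔ s ≡ n * q [MOD (p - 1)] := by
    rw [← pow_natCast_eq_iff D.prime D.order, ← D.half_eq,
      pow_half_eq_neg_one D.prime D.ne_two D.order, eq_neg_iff_add_eq_zero]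
    push_cast
    rw [add_comm]
  rw [orbitSum, Finset.sum_congr rfl fun b _ => h2 b, ← Finset.mul_sum, Finset.sum_add_distrib,
    Finset.sum_sub_distrib, Finset.sum_sub_distrib,
    sum_pow_mul_pow D.prime D.order D.primitive, sum_pow_mul_pow D.prime D.order D.primitive,
    sum_pow_mul_pow D.prime D.order D.primitive, if_neg hs, if_neg hs1]
  simp only [hs2, Finset.sum_const, Finset.card_range, nsmul_eq_mul]
  push_cast [hp1]
  split_ifs <;> ring

/-- Transitivity of the trace: `y` lies in `K`, so it passes through the inner sum. -/
theorem orbitSum_sum_mul (D : CyclicData p r n q ℓ ζ σ) (z y : L) (hy : (σ ^ n) y = y) :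
    orbitSum σ n ((∑ c ∈ Finset.range (2 * q), (σ ^ (n * c)) z) * y) =
      orbitSum σ (p - 1) (z * y) := by
  have hc : ∀ c, (σ ^ (n * c)) y = y := by
    intro c
    induction c with
    | zero => simp
    | succ c ih => rw [Nat.mul_succ, pow_add, AlgEquiv.mul_apply, hy, ih]
  rw [D.sub_one_eq, orbitSum, orbitSum, sum_range_mul _ n]
  rw [Finset.sum_comm (s := Finset.range (2 * q))]
  refine Finset.sum_congr rfl fun i _ => ?_
  rw [Finset.sum_mul, map_sum]
  refine Finset.sum_congr rfl fun c _ => ?_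
  rw [add_comm, pow_add, AlgEquiv.mul_apply, map_mul (σ ^ (n * c)), hc]

variable [IsCyclotomicExtension {p} ℚ L]

theorem coe_xElt (D : CyclicData p r n q ℓ ζ σ) : ((xElt σ n p r ℓ ζ : fixedK σ n) : L) =
    ∑ c ∈ Finset.range (2 * q), (σ ^ (n * c)) (zElt p r ℓ ζ) :=
  trace_fixedK D.prime D.primitive D.order D.apply_zeta D.sub_one_eq _

theorem sigma_pow_coe (y : fixedK σ n) : (σ ^ n) (y : L) = y := (mem_fixedK_iff σ n _).1 y.2

theorem sigma_pow_comm {y : L} (hy : (σ ^ n) y = y) (t : ℕ) :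
    (σ ^ n) ((σ ^ t) y) = (σ ^ t) y := by
  rw [← AlgEquiv.mul_apply, ← pow_add, add_comm, pow_add, AlgEquiv.mul_apply, hy]

theorem sum_neg_one_pow (D : CyclicData p r n q ℓ ζ σ) (t : ℕ) :
    ∑ c ∈ Finset.range (2 * q), (-1 : L) ^ (n * c + t) = 0 := by
  have h : ∀ c, (-1 : L) ^ (n * c + t) = (-1) ^ c * (-1) ^ t := fun c => by
    rw [pow_add, pow_mul, D.odd.neg_one_pow]
  rw [Finset.sum_congr rfl fun c _ => h c, ← Finset.sum_mul, neg_one_geom_sum,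
    if_pos (even_two_mul q), zero_mul]

theorem orbitSum_xElt_mul (D : CyclicData p r n q ℓ ζ σ) (t : ℕ) (ht : t < n) :
    orbitSum σ n ((xElt σ n p r ℓ ζ : fixedK σ n) * (σ ^ t) (xElt σ n p r ℓ ζ : fixedK σ n)) =
      if t = 0 then (p : L) ^ 2 else 0 := by
  have hx := sigma_pow_comm (sigma_pow_coe (xElt σ n p r ℓ ζ)) t
  have h0 : orbitSum σ n
      ((xElt σ n p r ℓ ζ : fixedK σ n) * (σ ^ t) (xElt σ n p r ℓ ζ : fixedK σ n) : L) =
      orbitSum σ (p - 1) (zElt p r ℓ ζ * (σ ^ t) (xElt σ n p r ℓ ζ : fixedK σ n)) := by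
    rw [← D.orbitSum_sum_mul _ _ hx, ← D.coe_xElt]
  have h1 : orbitSum σ (p - 1) (zElt p r ℓ ζ * (σ ^ t) (xElt σ n p r ℓ ζ : fixedK σ n)) =
      ∑ c ∈ Finset.range (2 * q), orbitSum σ (p - 1)
        (zElt p r ℓ ζ * (σ ^ (n * c + t)) (zElt p r ℓ ζ)) := by
    simp only [orbitSum]
    rw [Finset.sum_comm]
    refine Finset.sum_congr rfl fun b _ => ?_
    rw [← map_sum, ← Finset.mul_sum, D.coe_xElt, map_sum]
    refine congrArg _ (congrArg _ (Finset.sum_congr rfl fun c _ => ?_))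
    rw [add_comm, pow_add, AlgEquiv.mul_apply]
  have hpos : 0 < n * (2 * q) := by
    rw [← D.sub_one_eq]
    have := D.prime.two_le
    omega
  have hq : 0 < q := by
    rcases Nat.eq_zero_or_pos q with rfl | h
    · simp at hpos
    · exact h
  have h2 : ∀ c ∈ Finset.range (2 * q),
      orbitSum σ (p - 1) (zElt p r ℓ ζ * (σ ^ (n * c + t)) (zElt p r ℓ ζ)) =
        (-1) ^ (n * q) * p ^ 2 * (-1) ^ (n * c + t) +
          if c = q then (if t = 0 then (p : L) ^ 2 else 0) else 0 := by
    intro c hc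
    rw [Finset.mem_range] at hc
    -- Both sides are below `2nq`, so the congruence is an equality; reducing it modulo `n` gives `t
    -- = 0`.
    have hiff : n * c + t ≡ n * q [MOD (p - 1)] ↔ c = q ∧ t = 0 := by
      rw [D.sub_one_eq]
      constructor
      · intro h
        have h3 := h.eq_of_lt_of_lt (by nlinarith) (by nlinarith)
        have h4 := congrArg (· % n) h3
        simp only [Nat.mul_add_mod, Nat.mul_mod_right, Nat.mod_eq_of_lt ht] at h4
        subst h4
        exact ⟨Nat.eq_of_mul_eq_mul_left (by omega) h3, rfl⟩
      · rintro ⟨rfl, rfl⟩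
        rfl
    rw [D.orbitSum_zElt_mul]
    simp only [hiff]
    by_cases hcq : c = q
    · subst hcq
      by_cases ht0 : t = 0
      · subst ht0
        have h4 : ((-1 : L) ^ (n * c)) * (-1) ^ (n * c) = 1 := by
          rw [← mul_pow]
          simp
        simp only [and_self, if_true, add_zero]
        linear_combination (p : L) ^ 2 * h4
      · simp only [ht0, and_false, if_false, if_true]
        ring
    · simp only [hcq, false_and, if_false]
      ring
  rw [h0, h1, Finset.sum_congr rfl h2, Finset.sum_add_distrib, ← Finset.mul_sum,
    D.sum_neg_one_pow, Finset.sum_ite_eq', if_pos (Finset.mem_range.2 (by omega))]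
  ring

/-- The matrix of the trace form on the conjugates of `x` is `p²` times the identity. -/
theorem orbitSum_conj_mul_conj (D : CyclicData p r n q ℓ ζ σ) (i j : ℕ) (hi : i < n) (hj : j < n) :
    orbitSum σ n ((σ ^ i) (xElt σ n p r ℓ ζ : fixedK σ n) *
      (σ ^ j) (xElt σ n p r ℓ ζ : fixedK σ n)) = if i = j then (p : L) ^ 2 else 0 := by
  wlog hij : i ≤ j generalizing i j
  · rw [mul_comm, this j i hj hi (by omega)]
    simp only [eq_comm]
  obtain ⟨t, rfl⟩ := Nat.exists_eq_add_of_le hij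
  set x : L := ((xElt σ n p r ℓ ζ : fixedK σ n) : L) with hx
  have hxn : (σ ^ n) x = x := sigma_pow_coe _
  have hfix : (σ ^ n) (x * (σ ^ t) x) = x * (σ ^ t) x := by
    rw [map_mul, hxn, sigma_pow_comm hxn]
  have hsum : σ (orbitSum σ n (x * (σ ^ t) x)) = orbitSum σ n (x * (σ ^ t) x) :=
    sigma_orbitSum hfix
  -- The orbit sum is fixed by `σ`, so only the difference `t` of the two exponents matters.
  have hsumi : (σ ^ i) (orbitSum σ n (x * (σ ^ t) x)) = orbitSum σ n (x * (σ ^ t) x) := by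
    clear hi hj hij
    induction i with
    | zero => simp
    | succ i ih => rw [pow_succ, AlgEquiv.mul_apply, hsum, ih]
  have h1 : orbitSum σ n ((σ ^ i) x * (σ ^ (i + t)) x) = orbitSum σ n (x * (σ ^ t) x) := by
    rw [← hsumi]
    simp only [orbitSum, map_sum]
    refine Finset.sum_congr rfl fun k _ => ?_
    rw [pow_add, AlgEquiv.mul_apply, ← map_mul, ← AlgEquiv.mul_apply, ← AlgEquiv.mul_apply,
      ← pow_add, ← pow_add, add_comm]
  rw [h1, hx, D.orbitSum_xElt_mul t (by omega)]
  simp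

end CyclicData

end Algebraic

end RotatedDn

namespace RotatedDn

/-! ### Divisibility by `β` and `1 - ζ`, and the norm of `x` -/

section Divisibility

variable {L : Type*} [Field L] [NumberField L]

namespace CyclicData

variable {p r n q : ℕ} {ℓ : ℤ} {ζ : L} {σ : L ≃ₐ[ℚ] L}

theorem natCast_prime_ne_zero (D : CyclicData p r n q ℓ ζ σ) : (p : L) ≠ 0 :=
  Nat.cast_ne_zero.2 D.prime.ne_zero

theorem exists_sigma_pow_one_sub (D : CyclicData p r n q ℓ ζ σ) (j : ℕ) :
    ∃ c, IsIntegral ℤ c ∧ (σ ^ j) (1 - ζ) = (1 - ζ) * c := by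
  refine ⟨∑ i ∈ Finset.range (r ^ j), ζ ^ i, IsIntegral.sum _ fun i _ => D.isIntegral_zeta.pow i, ?_⟩
  rw [map_sub, map_one, pow_apply_of_apply_eq_pow D.apply_zeta, mul_neg_geom_sum]

theorem n_pos (D : CyclicData p r n q ℓ ζ σ) : 0 < n := D.odd.pos

theorem exists_orbitProd_one_sub (D : CyclicData p r n q ℓ ζ σ) :
    ∃ c, IsIntegral ℤ c ∧ orbitProd σ n (1 - ζ) = (1 - ζ) * c := by
  obtain ⟨k, rfl⟩ : ∃ k, n = k + 1 := ⟨n - 1, by have := D.n_pos; omega⟩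
  refine ⟨∏ i ∈ Finset.range k, (σ ^ (i + 1)) (1 - ζ),
    IsIntegral.prod _ fun i _ => isIntegral_apply _ D.isIntegral_one_sub, ?_⟩
  rw [orbitProd, Finset.prod_range_succ', mul_comm]
  rfl

variable [IsCyclotomicExtension {p} ℚ L]

theorem exists_one_sub_eq (D : CyclicData p r n q ℓ ζ σ) (j : ℕ) :
    ∃ c, IsIntegral ℤ c ∧ 1 - ζ = (σ ^ j) (1 - ζ) * c := by
  have hp := D.prime.two_le
  -- The exponent makes `σ^((p-1)j - j)` the inverse of `σ^j`.
  obtain ⟨c, hc, h⟩ := D.exists_sigma_pow_one_sub ((p - 1) * j - j)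
  refine ⟨(σ ^ j) c, isIntegral_apply _ hc, ?_⟩
  rw [← map_mul, ← h, ← AlgEquiv.mul_apply, ← pow_add, Nat.add_sub_cancel'
    (Nat.le_mul_of_pos_left j (by omega)), (sigma_pow_eq_one_iff D.prime D.primitive D.order
    D.apply_zeta _).2 (dvd_mul_right _ _)]
  rfl

theorem exists_sigma_pow_xElt (D : CyclicData p r n q ℓ ζ σ) (i : ℕ) :
    ∃ b, IsIntegral ℤ b ∧
      (σ ^ i) (xElt σ n p r ℓ ζ : fixedK σ n) = beta p r ℓ ζ * (1 - ζ) * b := by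
  choose c hc h using D.exists_sigma_pow_one_sub
  refine ⟨∑ k ∈ Finset.range (2 * q), (-1) ^ (i + n * k) * c (i + n * k),
    IsIntegral.sum _ fun k _ => (isIntegral_neg_one_pow _).mul (hc _), ?_⟩
  rw [D.coe_xElt, map_sum, Finset.mul_sum]
  refine Finset.sum_congr rfl fun k _ => ?_
  rw [← AlgEquiv.mul_apply, ← pow_add, zElt_eq, map_mul, D.sigma_pow_beta, h]
  ring

/-- The norm of an element of `K` divisible by `β (1 - ζ)` is divisible by `p^((n+1)/2)`. -/
theorem pow_dvd_of_orbitProd_eq (D : CyclicData p r n q ℓ ζ σ) {k : ℕ} (hk : n + 1 = 2 * k)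
    {y b : L} (hy : (σ ^ n) y = y) (hb : IsIntegral ℤ b) (h : y = beta p r ℓ ζ * (1 - ζ) * b)
    {a : ℤ} (ha : (a : L) = orbitProd σ n y) : (p : ℤ) ^ k ∣ a := by
  have hp0 := D.natCast_prime_ne_zero
  set b' := (-1) ^ (n * q) * ((1 - ζ) * b ^ 2) with hb'
  have hb'int : IsIntegral ℤ b' :=
    (isIntegral_neg_one_pow _).mul (D.isIntegral_one_sub.mul (hb.pow 2))
  have he : y ^ 2 = p * ((1 - ζ) * b') := by
    rw [h, hb']
    linear_combination (1 - ζ) ^ 2 * b ^ 2 * D.beta_sq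
  -- The factors need not lie in `K`, but their product is `y² / p`, so its norm is a rational
  -- integer.
  have hfix : (σ ^ n) ((1 - ζ) * b') = (1 - ζ) * b' := by
    have := congrArg (σ ^ n) he
    rw [map_pow, hy, he, map_mul, map_natCast] at this
    exact (mul_left_cancel₀ hp0 this).symm
  obtain ⟨e, hE⟩ := exists_int_orbitProd D.prime D.primitive D.order D.apply_zeta hfix
    (D.isIntegral_one_sub.mul hb'int)
  obtain ⟨c, hc, hc1⟩ := D.exists_orbitProd_one_sub
  have hdvd : (p : ℤ) ∣ e := by
    refine dvd_of_eq_one_sub_mul D.prime D.primitive D.order D.apply_zeta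
      (hc.mul (isIntegral_orbitProd (σ := σ) n hb'int)) ?_
    rw [hE, orbitProd_mul, hc1, mul_assoc]
  have hcast : orbitProd σ n (p : L) = (p : L) ^ n := by simp [orbitProd]
  have h2 : (a : L) ^ 2 = p ^ n * e := by
    rw [ha, ← orbitProd_pow, he, orbitProd_mul, hcast, hE]
  have h3 : a ^ 2 = (p : ℤ) ^ n * e := by exact_mod_cast h2
  rw [← Int.pow_dvd_pow_iff two_ne_zero, ← pow_mul, mul_comm k, ← hk, h3, pow_succ]
  exact mul_dvd_mul_left _ hdvd

/-- There is an element of `K` of norm `p^((n+1)/2)` which is divisible by `β`. -/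
theorem exists_orbitProd_eq_pow (D : CyclicData p r n q ℓ ζ σ) {k : ℕ} (hk : n + 1 = 2 * k) :
    ∃ w v : L, (σ ^ n) w = w ∧ orbitProd σ n w = (p : L) ^ k ∧ IsIntegral ℤ v ∧
      w = beta p r ℓ ζ * v := by
  -- `ν` is the relative norm of `1 - ζ`; it has norm `p`, so `ν^k` is the required element.
  set ν : L := ∏ c ∈ Finset.range (2 * q), (σ ^ (n * c)) (1 - ζ) with hν
  have hβ := D.beta_ne_zero
  have hνint : IsIntegral ℤ ν := IsIntegral.prod _ fun _ _ => isIntegral_apply _ D.isIntegral_one_sub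
  have hνfix : (σ ^ n) ν = ν := by
    have e : ν = orbitProd (σ ^ n) (2 * q) (1 - ζ) := by
      simp only [hν, orbitProd, pow_mul]
    rw [e]
    refine sigma_orbitProd ?_
    rw [← pow_mul, ← D.sub_one_eq]
    exact sigma_pow_sub_one D.prime D.primitive D.order D.apply_zeta _
  have hνprod : orbitProd σ n ν = p := by
    rw [← orbitProd_one_sub D.prime D.primitive D.order D.apply_zeta, D.sub_one_eq, orbitProd,
      orbitProd, prod_range_mul _ n, Finset.prod_comm]
    refine Finset.prod_congr rfl fun i _ => ?_
    rw [hν, map_prod]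
    refine Finset.prod_congr rfl fun c _ => ?_
    rw [← AlgEquiv.mul_apply, ← pow_add, add_comm]
  choose d hd hd1 using D.exists_one_sub_eq
  -- The conjugates of `1 - ζ` divide one another, so `ν^n` is `p` times an integer. Therefore `(ν^k
  -- / β)² = ± ν · (ν^n / p)` is integral.
  have hνn : ν ^ n = p * ∏ c ∈ Finset.range (2 * q), ∏ i ∈ Finset.range n, (σ ^ (n * c)) (d i) := by
    rw [← orbitProd_one_sub D.prime D.primitive D.order D.apply_zeta, D.sub_one_eq, orbitProd,
      prod_range_mul, ← Finset.prod_mul_distrib, hν, ← Finset.prod_pow]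
    refine Finset.prod_congr rfl fun c _ => ?_
    rw [← Finset.prod_mul_distrib, Finset.pow_eq_prod_const]
    refine Finset.prod_congr rfl fun i _ => ?_
    rw [pow_add, AlgEquiv.mul_apply, ← map_mul, ← hd1]
  refine ⟨ν ^ k, ν ^ k / beta p r ℓ ζ, by rw [map_pow, hνfix], by rw [orbitProd_pow, hνprod], ?_,
    by field_simp⟩
  refine IsIntegral.of_pow two_pos ?_
  have e : (ν ^ k / beta p r ℓ ζ) ^ 2 = (-1) ^ (n * q) *
      (ν * ∏ c ∈ Finset.range (2 * q), ∏ i ∈ Finset.range n, (σ ^ (n * c)) (d i)) := by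
    have h4 : ((-1 : L) ^ (n * q)) * (-1) ^ (n * q) = 1 := by
      rw [← mul_pow]
      simp
    rw [div_pow, div_eq_iff (pow_ne_zero 2 hβ), D.beta_sq, ← pow_mul, mul_comm k, ← hk, pow_succ,
      hνn]
    linear_combination (-(p : L) * (∏ c ∈ Finset.range (2 * q), ∏ i ∈ Finset.range n,
      (σ ^ (n * c)) (d i)) * ν) * h4
  rw [e]
  exact (isIntegral_neg_one_pow _).mul (hνint.mul
    (IsIntegral.prod _ fun c _ => IsIntegral.prod _ fun i _ => isIntegral_apply _ (hd i)))

/-- One factor `p` comes from `β²`. The other comes from the trace of a multiple of `1 - ζ`, a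
rational integer still divisible by `1 - ζ`, hence by `p`. -/
theorem exists_orbitSum_mul_eq (D : CyclicData p r n q ℓ ζ σ) {w v : L} (hw : (σ ^ n) w = w)
    (hv : IsIntegral ℤ v) (h : w = beta p r ℓ ζ * v) (i : ℕ) :
    ∃ a : ℤ, orbitSum σ n (w * (σ ^ i) (xElt σ n p r ℓ ζ : fixedK σ n)) = a * (p : L) ^ 2 := by
  have hp0 := D.natCast_prime_ne_zero
  obtain ⟨b, hb, hx⟩ := D.exists_sigma_pow_xElt i
  have hxfix := sigma_pow_comm (sigma_pow_coe (xElt σ n p r ℓ ζ)) i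
  set e := (1 - ζ) * ((-1) ^ (n * q) * v * b) with he
  have heint : IsIntegral ℤ ((-1) ^ (n * q) * v * b) :=
    ((isIntegral_neg_one_pow _).mul hv).mul hb
  have hwx : w * (σ ^ i) (xElt σ n p r ℓ ζ : fixedK σ n) = p * e := by
    rw [hx, h, he]
    linear_combination v * (1 - ζ) * b * D.beta_sq
  have hfix : (σ ^ n) e = e := by
    have := congrArg (σ ^ n) hwx
    rw [map_mul, hw, hxfix, hwx, map_mul, map_natCast] at this
    exact (mul_left_cancel₀ hp0 this).symm
  obtain ⟨t, ht⟩ := exists_intCast_of_sigma_fixed D.prime D.primitive D.order D.apply_zeta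
    (sigma_orbitSum hfix) (isIntegral_orbitSum n (D.isIntegral_one_sub.mul heint))
  choose c hc hc1 using D.exists_sigma_pow_one_sub
  obtain ⟨a, rfl⟩ : (p : ℤ) ∣ t := by
    refine dvd_of_eq_one_sub_mul D.prime D.primitive D.order D.apply_zeta
      (b := ∑ j ∈ Finset.range n, c j * (σ ^ j) ((-1) ^ (n * q) * v * b))
      (IsIntegral.sum _ fun j _ => (hc j).mul (isIntegral_apply _ heint)) ?_
    rw [ht, orbitSum, Finset.mul_sum]
    refine Finset.sum_congr rfl fun j _ => ?_
    rw [he, map_mul, hc1, mul_assoc]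
  refine ⟨a, ?_⟩
  have h5 : orbitSum σ n ((p : L) * e) = p * orbitSum σ n e := by
    simp only [orbitSum, map_mul, map_natCast, Finset.mul_sum]
  rw [hwx, h5, ← ht]
  push_cast
  ring

theorem xElt_ne_zero (D : CyclicData p r n q ℓ ζ σ) :
    ((xElt σ n p r ℓ ζ : fixedK σ n) : L) ≠ 0 := by
  intro h
  have h1 := D.orbitSum_xElt_mul 0 D.n_pos
  rw [h, if_pos rfl, zero_mul] at h1
  refine pow_ne_zero 2 D.natCast_prime_ne_zero (h1.symm.trans ?_)
  simp [orbitSum]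

/-- If `σ x / x` is integral then so are all `σ^i x / x`. -/
theorem isIntegral_sigma_pow_div {x : L} (hx : x ≠ 0) (h : IsIntegral ℤ (σ x / x)) (i : ℕ) :
    IsIntegral ℤ ((σ ^ i) x / x) := by
  induction i with
  | zero => simpa [hx] using isIntegral_one
  | succ i ih =>
    have e : (σ ^ (i + 1)) x / x = σ ((σ ^ i) x / x) * (σ x / x) := by
      have := (map_ne_zero σ).2 hx
      rw [map_div₀, pow_succ', AlgEquiv.mul_apply]
      field_simp
    rw [e]
    exact (isIntegral_apply σ ih).mul h

/-- If the conjugates of `x` generate every element of `K` divisible by `β`, and `σ x / x` is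
integral, then `x` has norm `± p^((n+1)/2)`. -/
theorem orbitProd_xElt (D : CyclicData p r n q ℓ ζ σ) {k : ℕ} (hk : n + 1 = 2 * k)
    (hspan : ∀ w v : L, (σ ^ n) w = w → IsIntegral ℤ v → w = beta p r ℓ ζ * v →
      ∃ a : ℕ → ℤ, w = ∑ i ∈ Finset.range n, a i * (σ ^ i) (xElt σ n p r ℓ ζ : fixedK σ n))
    (hu : IsIntegral ℤ (σ (xElt σ n p r ℓ ζ : fixedK σ n) / (xElt σ n p r ℓ ζ : fixedK σ n))) :
    orbitProd σ n (xElt σ n p r ℓ ζ : fixedK σ n) = (p : L) ^ k ∨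
      orbitProd σ n (xElt σ n p r ℓ ζ : fixedK σ n) = -(p : L) ^ k := by
  obtain ⟨w, v, hw, hwp, hv, hwv⟩ := D.exists_orbitProd_eq_pow hk
  obtain ⟨a, ha⟩ := hspan w v hw hv hwv
  have hx0 := D.xElt_ne_zero
  have hxfix : (σ ^ n) (xElt σ n p r ℓ ζ : fixedK σ n) = (xElt σ n p r ℓ ζ : fixedK σ n) :=
    sigma_pow_coe _
  obtain ⟨b, hb, hxb⟩ := D.exists_sigma_pow_xElt 0
  rw [pow_zero, AlgEquiv.one_apply] at hxb
  have hxint : IsIntegral ℤ ((xElt σ n p r ℓ ζ : fixedK σ n) : L) :=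
    hxb ▸ (D.isIntegral_beta.mul D.isIntegral_one_sub).mul hb
  generalize ((xElt σ n p r ℓ ζ : fixedK σ n) : L) = x at *
  have hy : IsIntegral ℤ (w / x) := by
    rw [ha, Finset.sum_div]
    refine IsIntegral.sum _ fun i _ => ?_
    rw [mul_div_assoc]
    refine IsIntegral.mul ?_ (isIntegral_sigma_pow_div hx0 hu i)
    simpa using isIntegral_algebraMap (R := ℤ) (A := L) (x := a i)
  have hyfix : (σ ^ n) (w / x) = w / x := by rw [map_div₀, hw, hxfix]
  obtain ⟨A, hA⟩ := exists_int_orbitProd D.prime D.primitive D.order D.apply_zeta hyfix hy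
  obtain ⟨X, hX⟩ := exists_int_orbitProd D.prime D.primitive D.order D.apply_zeta hxfix hxint
  obtain ⟨Y, rfl⟩ := D.pow_dvd_of_orbitProd_eq hk hxfix hb hxb hX
  -- Norms in `w = x · (w / x)`: the cofactor `Y` of `p^k` in the norm of `x` must be `± 1`.
  have h1 : ((((p : ℤ) ^ k * Y : ℤ) : L)) * A = (p : L) ^ k := by
    rw [hX, hA, ← orbitProd_mul, mul_div_cancel₀ _ hx0, hwp]
  have h2 : (p : ℤ) ^ k * Y * A = (p : ℤ) ^ k := by exact_mod_cast h1
  have h3 : Y * A = 1 := by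
    have hp : (p : ℤ) ^ k ≠ 0 := pow_ne_zero _ (by exact_mod_cast D.prime.ne_zero)
    apply mul_left_cancel₀ hp
    linear_combination h2
  rcases Int.eq_one_or_neg_one_of_mul_eq_one h3 with rfl | rfl
  · left
    rw [← hX]
    simp
  · right
    rw [← hX]
    simp

theorem orbitProd_unit (D : CyclicData p r n q ℓ ζ σ) {e e' : L} (he : (σ ^ n) e = e)
    (he' : (σ ^ n) e' = e') (hi : IsIntegral ℤ e) (hi' : IsIntegral ℤ e') (h : e * e' = 1) :
    orbitProd σ n e = 1 ∨ orbitProd σ n e = -1 := by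
  obtain ⟨A, hA⟩ := exists_int_orbitProd D.prime D.primitive D.order D.apply_zeta he hi
  obtain ⟨B, hB⟩ := exists_int_orbitProd D.prime D.primitive D.order D.apply_zeta he' hi'
  have h1 : (A : L) * B = 1 := by
    rw [hA, hB, ← orbitProd_mul, h]
    simp [orbitProd]
  have h2 : A * B = 1 := by exact_mod_cast h1
  rw [← hA]
  rcases Int.eq_one_or_neg_one_of_mul_eq_one h2 with rfl | rfl
  · left; simp
  · right; simp

end CyclicData

end Divisibility

end RotatedDn

namespace RotatedDn

/-! ### Real embeddings, the orthonormal basis and `D_n` -/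

section Geometry

variable {L : Type*} [Field L] [NumberField L]

theorem coe_sigmaK_pow (σ : L ≃ₐ[ℚ] L) (n i : ℕ) (y : fixedK σ n) :
    (((sigmaK σ n ^ i) y : fixedK σ n) : L) = (σ ^ i) (y : L) := by
  induction i with
  | zero => simp
  | succ i ih => rw [pow_succ', pow_succ', AlgHom.mul_apply, AlgEquiv.mul_apply, coe_sigmaK, ih]

theorem sum_mem_closure_of_even {A : Type*} [AddCommGroup A] {n : ℕ} (hn : 1 < n) (g : ℕ → A)
    (a : Fin n → ℤ) {k : ℤ} (ha : ∑ i, a i = 2 * k) :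
    ∑ i, a i • g i ∈ AddSubgroup.closure
      ({g 0 + g 1} ∪ {y | ∃ i < n - 1, y = g i - g (i + 1)}) := by
  set S := AddSubgroup.closure ({g 0 + g 1} ∪ {y | ∃ i < n - 1, y = g i - g (i + 1)}) with hS
  have h1 : ∀ i < n, g i - g 0 ∈ S := by
    intro i
    induction i with
    | zero => intro; simp [S.zero_mem]
    | succ i ih =>
      intro hi
      have h2 : g i - g (i + 1) ∈ S := AddSubgroup.subset_closure (Or.inr ⟨i, by omega, rfl⟩)
      have := S.sub_mem (ih (by omega)) h2
      convert this using 1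
      abel
  have h3 : (2 : ℤ) • g 0 ∈ S := by
    have h4 : g 0 + g 1 ∈ S := AddSubgroup.subset_closure (Or.inl rfl)
    have := S.sub_mem h4 (h1 1 hn)
    convert this using 1
    abel
  -- An even coefficient sum `2k` turns the remainder into a multiple of `2 g 0 = (g 0 + g 1) - (g 1
  -- - g 0)`.
  have h5 : ∑ i, a i • g i = ∑ i, a i • (g i - g 0) + k • (2 : ℤ) • g 0 := by
    rw [smul_smul, mul_comm k, ← ha, Finset.sum_smul, ← Finset.sum_add_distrib]
    refine Finset.sum_congr rfl fun i _ => ?_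
    rw [smul_sub]
    abel
  rw [h5]
  exact S.add_mem (S.sum_mem fun i _ => S.zsmul_mem (h1 i i.2) _) (S.zsmul_mem h3 _)

theorem twistedHom_apply (F : Type*) [Field F] [NumberField F] (p : ℕ) (y : F) (τ : F →+* ℝ) :
    twistedHom F (1 / (p : F) ^ 2) y τ = τ y / p := by
  have h : twistedHom F (1 / (p : F) ^ 2) y τ = Real.sqrt (τ (1 / (p : F) ^ 2)) * τ y := rfl
  rw [h, map_div₀, map_one, map_pow, map_natCast, Real.sqrt_div zero_le_one, Real.sqrt_one,
    Real.sqrt_sq (Nat.cast_nonneg p)]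
  ring

theorem inner_twistedHom (F : Type*) [Field F] [NumberField F] (p : ℕ) (y w : F) :
    inner ℝ (twistedHom F (1 / (p : F) ^ 2) y) (twistedHom F (1 / (p : F) ^ 2) w) =
      (∑ τ : F →+* ℝ, τ (y * w)) / (p : ℝ) ^ 2 := by
  rw [PiLp.inner_apply, Finset.sum_div]
  refine Finset.sum_congr rfl fun τ _ => ?_
  rw [twistedHom_apply, twistedHom_apply, map_mul, real_inner_eq_re_inner, RCLike.inner_apply]
  simp only [conj_trivial, RCLike.re_to_real]
  ring

namespace CyclicData

variable {p r n q : ℕ} {ℓ : ℤ} {ζ : L} {σ : L ≃ₐ[ℚ] L} [IsCyclotomicExtension {p} ℚ L]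

/-- Complex conjugation inverts roots of unity, so it acts on `L` as `σ^(nq)`, a power of `σ^n`, and
is trivial on `K`. -/
theorem exists_real_embedding (D : CyclicData p r n q ℓ ζ σ) :
    Nonempty (fixedK σ n →+* ℝ) := by
  obtain ⟨φ⟩ : Nonempty (L →+* ℂ) := inferInstance
  have hconj : ∀ y : L, starRingEnd ℂ (φ y) = φ ((σ ^ (n * q)) y) := by
    have h1 : (((starRingEnd ℂ).comp φ).toRatAlgHom : L →ₐ[ℚ] ℂ) =
        (φ.comp ((σ ^ (n * q) : L ≃ₐ[ℚ] L) : L →+* L)).toRatAlgHom := by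
      refine algHom_ext_of_isPrimitiveRoot D.prime D.primitive ?_
      change starRingEnd ℂ (φ ζ) = φ ((σ ^ (n * q)) ζ)
      rw [pow_apply_of_apply_eq_pow D.apply_zeta, D.zeta_pow_half, map_inv₀, Complex.inv_eq_conj]
      refine Complex.norm_eq_one_of_pow_eq_one (n := p) ?_ D.prime.ne_zero
      rw [← map_pow, D.primitive.pow_eq_one, map_one]
    intro y
    exact DFunLike.congr_fun h1 y
  have hreal : NumberField.ComplexEmbedding.IsReal (φ.comp (algebraMap (fixedK σ n) L)) := by
    rw [NumberField.ComplexEmbedding.isReal_iff]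
    ext y
    change starRingEnd ℂ (φ (y : L)) = φ (y : L)
    rw [hconj, pow_mul]
    congr 1
    have : ∀ c, ((σ ^ n) ^ c) (y : L) = y := by
      intro c
      induction c with
      | zero => simp
      | succ c ih => rw [pow_succ, AlgEquiv.mul_apply, sigma_pow_coe, ih]
    exact this q
  exact ⟨hreal.embedding⟩

/-- The degree bounds the number of embeddings by `n`, and these `n` are distinct on `x`: equal
conjugates could not be orthogonal. -/
theorem bijective_embeddings (D : CyclicData p r n q ℓ ζ σ) (τ₀ : fixedK σ n →+* ℝ) :
    Function.Bijective
      fun i : Fin n => τ₀.comp ((sigmaK σ n ^ (i : ℕ) : fixedK σ n →ₐ[ℚ] fixedK σ n) :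
        fixedK σ n →+* fixedK σ n) := by
  have hcard : Fintype.card (fixedK σ n →+* ℝ) ≤ n := by
    have h1 := NumberField.Embeddings.card (fixedK σ n) ℂ
    rw [finrank_fixedK D.prime D.primitive D.order D.apply_zeta D.sub_one_eq] at h1
    refine le_of_le_of_eq ?_ h1
    refine Fintype.card_le_of_injective (fun τ => Complex.ofRealHom.comp τ) fun τ τ' h => ?_
    ext y
    exact Complex.ofReal_injective (DFunLike.congr_fun h y)
  refine Function.Injective.bijective_of_nat_card_le ?_ (by simpa using hcard)
  intro i j h
  have h1 := DFunLike.congr_fun h (xElt σ n p r ℓ ζ)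
  have h2 : (sigmaK σ n ^ (i : ℕ)) (xElt σ n p r ℓ ζ) = (sigmaK σ n ^ (j : ℕ)) (xElt σ n p r ℓ ζ) :=
    τ₀.injective h1
  have h3 := congrArg (fun y : fixedK σ n => (y : L)) h2
  simp only [coe_sigmaK_pow] at h3
  by_contra hij
  have h4 := D.orbitSum_conj_mul_conj i i i.2 i.2
  have h5 := D.orbitSum_conj_mul_conj i j i.2 j.2
  rw [← h3, h4, if_pos rfl, if_neg (fun e => hij (Fin.ext e))] at h5
  exact pow_ne_zero 2 D.natCast_prime_ne_zero h5

theorem sum_embeddings (D : CyclicData p r n q ℓ ζ σ) (y : fixedK σ n) (a : ℚ)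
    (h : orbitSum σ n (y : L) = a) : ∑ τ : fixedK σ n →+* ℝ, τ y = a := by
  obtain ⟨τ₀⟩ := D.exists_real_embedding
  rw [← (D.bijective_embeddings τ₀).sum_comp (fun τ => τ y)]
  change ∑ i : Fin n, τ₀ ((sigmaK σ n ^ (i : ℕ)) y) = a
  rw [← map_sum, ← map_ratCast τ₀ a]
  congr 1
  apply (algebraMap (fixedK σ n) L).injective
  rw [Fin.sum_univ_eq_sum_range (fun i => (sigmaK σ n ^ i) y) n]
  rw [map_sum, map_ratCast, ← h]
  exact Finset.sum_congr rfl fun i _ => coe_sigmaK_pow σ n i y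

theorem prod_embeddings (D : CyclicData p r n q ℓ ζ σ) (y : fixedK σ n) (a : ℚ)
    (h : orbitProd σ n (y : L) = a) : ∏ τ : fixedK σ n →+* ℝ, τ y = a := by
  obtain ⟨τ₀⟩ := D.exists_real_embedding
  rw [← (D.bijective_embeddings τ₀).prod_comp (fun τ => τ y)]
  change ∏ i : Fin n, τ₀ ((sigmaK σ n ^ (i : ℕ)) y) = a
  rw [← map_prod, ← map_ratCast τ₀ a]
  congr 1
  apply (algebraMap (fixedK σ n) L).injective
  rw [Fin.prod_univ_eq_prod_range (fun i => (sigmaK σ n ^ i) y) n]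
  rw [map_prod, map_ratCast, ← h]
  exact Finset.prod_congr rfl fun i _ => coe_sigmaK_pow σ n i y

theorem card_embeddings (D : CyclicData p r n q ℓ ζ σ) :
    Fintype.card (fixedK σ n →+* ℝ) = n := by
  obtain ⟨τ₀⟩ := D.exists_real_embedding
  rw [← Fintype.card_of_bijective (D.bijective_embeddings τ₀), Fintype.card_fin]

theorem twistedHom_injective (D : CyclicData p r n q ℓ ζ σ) :
    Function.Injective (twistedHom (fixedK σ n) (1 / (p : fixedK σ n) ^ 2)) := by
  obtain ⟨τ₀⟩ := D.exists_real_embedding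
  have hp : (p : ℝ) ≠ 0 := Nat.cast_ne_zero.2 D.prime.ne_zero
  intro y w h
  have h1 := congrArg (fun v => v.ofLp τ₀) h
  simp only [twistedHom_apply] at h1
  exact τ₀.injective ((div_left_inj' hp).1 h1)

theorem orthonormal_conj (D : CyclicData p r n q ℓ ζ σ) :
    Orthonormal ℝ fun i : Fin n => twistedHom (fixedK σ n) (1 / (p : fixedK σ n) ^ 2)
      ((sigmaK σ n ^ (i : ℕ)) (xElt σ n p r ℓ ζ)) := by
  have hp : (p : ℝ) ≠ 0 := Nat.cast_ne_zero.2 D.prime.ne_zero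
  rw [orthonormal_iff_ite]
  intro i j
  rw [inner_twistedHom, D.sum_embeddings _ (if i = j then (p : ℚ) ^ 2 else 0)]
  · split_ifs
    · push_cast
      exact div_self (pow_ne_zero 2 hp)
    · simp
  · rw [MulMemClass.coe_mul, coe_sigmaK_pow, coe_sigmaK_pow,
      D.orbitSum_conj_mul_conj i j i.2 j.2]
    simp only [Fin.ext_iff]
    split_ifs <;> simp

/-- The orthonormal basis of the vectors `φ (σ^i x)`. -/
theorem exists_orthonormalBasis (D : CyclicData p r n q ℓ ζ σ) :
    ∃ b : OrthonormalBasis (Fin n) ℝ (EuclideanSpace ℝ (fixedK σ n →+* ℝ)),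
      ∀ i : Fin n, b i = twistedHom (fixedK σ n) (1 / (p : fixedK σ n) ^ 2)
        ((sigmaK σ n ^ (i : ℕ)) (xElt σ n p r ℓ ζ)) := by
  have hspan := D.orthonormal_conj.linearIndependent.span_eq_top_of_card_eq_finrank' (by
    rw [finrank_euclideanSpace, D.card_embeddings, Fintype.card_fin])
  exact ⟨OrthonormalBasis.mk D.orthonormal_conj hspan.ge, fun i => by
    rw [OrthonormalBasis.coe_mk]⟩

/-- The coordinates of `φ(w)` in the orthonormal basis are the traces of `w · σ^i x` divided by
`p²`, and these are integers. -/
theorem exists_eq_sum_conj (D : CyclicData p r n q ℓ ζ σ) {w v : L} (hw : (σ ^ n) w = w)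
    (hv : IsIntegral ℤ v) (h : w = beta p r ℓ ζ * v) :
    ∃ a : ℕ → ℤ, w = ∑ i ∈ Finset.range n, a i * (σ ^ i) (xElt σ n p r ℓ ζ : fixedK σ n) := by
  obtain ⟨b, hb⟩ := D.exists_orthonormalBasis
  have hp : (p : ℝ) ≠ 0 := Nat.cast_ne_zero.2 D.prime.ne_zero
  choose a ha using fun i => D.exists_orbitSum_mul_eq hw hv h i
  refine ⟨a, ?_⟩
  set W : fixedK σ n := ⟨w, (mem_fixedK_iff σ n w).2 hw⟩ with hW
  have h1 : ∀ i : Fin n, inner ℝ (b i) (twistedHom (fixedK σ n) (1 / (p : fixedK σ n) ^ 2) W) =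
      a i := by
    intro i
    rw [hb, real_inner_comm, inner_twistedHom, D.sum_embeddings _ (a i * (p : ℚ) ^ 2)]
    · push_cast
      exact mul_div_cancel_right₀ _ (pow_ne_zero 2 hp)
    · rw [MulMemClass.coe_mul, coe_sigmaK_pow, ha]
      push_cast
      rfl
  have h2 : W = ∑ i : Fin n, a i • (sigmaK σ n ^ (i : ℕ)) (xElt σ n p r ℓ ζ) := by
    apply D.twistedHom_injective
    rw [map_sum, ← b.sum_repr' (twistedHom (fixedK σ n) (1 / (p : fixedK σ n) ^ 2) W)]
    refine Finset.sum_congr rfl fun i _ => ?_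
    rw [h1, map_zsmul, hb, Int.cast_smul_eq_zsmul]
  have h3 := congrArg (algebraMap (fixedK σ n) L) h2
  rw [Fin.sum_univ_eq_sum_range (fun i => a i • (sigmaK σ n ^ i) (xElt σ n p r ℓ ζ)) n,
    map_sum] at h3
  refine h3.trans (Finset.sum_congr rfl fun i _ => ?_)
  rw [map_zsmul, zsmul_eq_mul]
  exact congrArg _ (coe_sigmaK_pow σ n i _)

theorem isRotatedVersion (D : CyclicData p r n q ℓ ζ σ) (hn : 1 < n) :
    IsRotatedVersion (rotatedLattice σ n p (xElt σ n p r ℓ ζ)) (latticeD n) := by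
  obtain ⟨b, hb⟩ := D.exists_orthonormalBasis
  set φ := twistedHom (fixedK σ n) (1 / (p : fixedK σ n) ^ 2) with hφ
  set g : ℕ → fixedK σ n := fun i => (sigmaK σ n ^ i) (xElt σ n p r ℓ ζ) with hg
  have hsingle : ∀ i : Fin n, b.repr.symm (EuclideanSpace.single i 1) = φ (g i) := fun i => by
    rw [b.repr_symm_single, hb]
  have hM : moduleM σ n (xElt σ n p r ℓ ζ) = AddSubgroup.closure
      ({g 0 + g 1} ∪ {y | ∃ i < n - 1, y = g i - g (i + 1)}) := by
    simp [moduleM, hg]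
  refine ⟨b.repr.symm, Set.Subset.antisymm ?_ ?_⟩
  · rintro _ ⟨v, ⟨a, ha, k, hk⟩, rfl⟩
    refine ⟨∑ i, a i • g i, ?_, ?_⟩
    · rw [hM]
      exact sum_mem_closure_of_even hn g a hk
    · rw [← b.sum_repr_symm, map_sum]
      refine Finset.sum_congr rfl fun i _ => ?_
      rw [map_zsmul, ha, hb, Int.cast_smul_eq_zsmul]
  · have hle : moduleM σ n (xElt σ n p r ℓ ζ) ≤
        ((latticeD n).map (b.repr.symm : EuclideanSpace ℝ (Fin n) →+
          EuclideanSpace ℝ (fixedK σ n →+* ℝ))).comap φ := by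
      rw [hM, AddSubgroup.closure_le]
      -- With `e = ± 1` these are the vectors to which the generators of `M` correspond.
      have hmem : ∀ i j : Fin n, i ≠ j → ∀ e : ℤ, e = 1 ∨ e = -1 →
          EuclideanSpace.single i (1 : ℝ) + (e : ℝ) • EuclideanSpace.single j 1 ∈ latticeD n := by
        intro i j _ e he
        refine ⟨Pi.single i 1 + e • Pi.single j 1, fun k => ?_, ?_⟩
        · simp only [PiLp.add_apply, PiLp.smul_apply, PiLp.single_apply, Pi.add_apply,
            Pi.smul_apply, Pi.single_apply]
          push_cast
          simp
        · simp only [Pi.add_apply, Pi.smul_apply, Finset.sum_add_distrib, ← Finset.smul_sum,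
            Finset.sum_pi_single', Finset.mem_univ, if_true]
          rcases he with rfl | rfl
          · exact ⟨1, by simp⟩
          · exact ⟨0, by simp⟩
      rintro y (rfl | ⟨i, hi, rfl⟩)
      · refine ⟨_, hmem ⟨0, by omega⟩ ⟨1, hn⟩ (by simp) 1 (Or.inl rfl), ?_⟩
        change b.repr.symm _ = φ _
        rw [map_add, map_smul, hsingle, hsingle, map_add]
        simp
      · refine ⟨_, hmem ⟨i, by omega⟩ ⟨i + 1, by omega⟩ (by simp) (-1) (Or.inr rfl), ?_⟩
        change b.repr.symm _ = φ _
        rw [map_add, map_smul, hsingle, hsingle, map_sub]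
        simp [sub_eq_add_neg]
    rintro _ ⟨y, hy, rfl⟩
    exact hle hy

end CyclicData

end Geometry

end RotatedDn

namespace RotatedDn

/-! ### Diversity and the minimum product distance -/

section ProductDistance

variable {L : Type*} [Field L] [NumberField L]

namespace CyclicData

variable {p r n q : ℕ} {ℓ : ℤ} {ζ : L} {σ : L ≃ₐ[ℚ] L} [IsCyclotomicExtension {p} ℚ L]

theorem hasMaximumDiversity (D : CyclicData p r n q ℓ ζ σ) (x : fixedK σ n) :
    HasMaximumDiversity (rotatedLattice σ n p x) := by
  have hp : (p : ℝ) ≠ 0 := Nat.cast_ne_zero.2 D.prime.ne_zero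
  rintro _ ⟨y, -, rfl⟩ h0 τ
  rw [twistedHom_apply]
  refine div_ne_zero ((map_ne_zero τ).2 ?_) hp
  rintro rfl
  exact h0 (map_zero _)

theorem abs_prod_twistedHom (D : CyclicData p r n q ℓ ζ σ) (y : fixedK σ n) {a : ℤ}
    (h : orbitProd σ n (y : L) = a) :
    |∏ τ, twistedHom (fixedK σ n) (1 / (p : fixedK σ n) ^ 2) y τ| = |(a : ℝ)| / (p : ℝ) ^ n := by
  simp only [twistedHom_apply]
  rw [Finset.prod_div_distrib, Finset.prod_const, Finset.card_univ, D.card_embeddings,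
    D.prod_embeddings y a (by rw [h]; simp), abs_div, abs_pow, Nat.abs_cast]
  simp

theorem exists_of_mem_moduleM (D : CyclicData p r n q ℓ ζ σ) {y : fixedK σ n}
    (hy : y ∈ moduleM σ n (xElt σ n p r ℓ ζ)) :
    ∃ b, IsIntegral ℤ b ∧ (y : L) = beta p r ℓ ζ * (1 - ζ) * b := by
  have hconj : ∀ i, ∃ b, IsIntegral ℤ b ∧ (((sigmaK σ n ^ i) (xElt σ n p r ℓ ζ) : fixedK σ n) : L) =
      beta p r ℓ ζ * (1 - ζ) * b := fun i => by
    rw [coe_sigmaK_pow]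
    exact D.exists_sigma_pow_xElt i
  induction hy using AddSubgroup.closure_induction with
  | mem y hy =>
    rcases hy with rfl | ⟨i, -, rfl⟩
    · obtain ⟨b, hb, h⟩ := hconj 0
      obtain ⟨c, hc, h'⟩ := hconj 1
      rw [pow_zero, AlgHom.one_apply] at h
      rw [pow_one] at h'
      exact ⟨b + c, hb.add hc, by rw [AddMemClass.coe_add, h, h']; ring⟩
    · obtain ⟨b, hb, h⟩ := hconj i
      obtain ⟨c, hc, h'⟩ := hconj (i + 1)
      exact ⟨b - c, hb.sub hc, by rw [AddSubgroupClass.coe_sub, h, h']; ring⟩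
  | zero => exact ⟨0, isIntegral_zero, by simp⟩
  | add y w _ _ hy hw =>
    obtain ⟨b, hb, h⟩ := hy
    obtain ⟨c, hc, h'⟩ := hw
    exact ⟨b + c, hb.add hc, by rw [AddMemClass.coe_add, h, h']; ring⟩
  | neg y _ hy =>
    obtain ⟨b, hb, h⟩ := hy
    exact ⟨-b, hb.neg, by rw [NegMemClass.coe_neg, h]; ring⟩

theorem le_abs_prod_twistedHom (D : CyclicData p r n q ℓ ζ σ) {k : ℕ} (hk : n + 1 = 2 * k)
    {y : fixedK σ n} (hy : y ∈ moduleM σ n (xElt σ n p r ℓ ζ)) (hy0 : y ≠ 0) :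
    (p : ℝ) ^ k / (p : ℝ) ^ n ≤
      |∏ τ, twistedHom (fixedK σ n) (1 / (p : fixedK σ n) ^ 2) y τ| := by
  obtain ⟨b, hb, h⟩ := D.exists_of_mem_moduleM hy
  have hyint : IsIntegral ℤ (y : L) := h ▸ (D.isIntegral_beta.mul D.isIntegral_one_sub).mul hb
  obtain ⟨a, ha⟩ := exists_int_orbitProd D.prime D.primitive D.order D.apply_zeta
    (sigma_pow_coe y) hyint
  have hdvd := D.pow_dvd_of_orbitProd_eq hk (sigma_pow_coe y) hb h ha
  have ha0 : a ≠ 0 := by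
    rintro rfl
    refine orbitProd_ne_zero (σ := σ) n (y := (y : L)) (fun e => hy0 (Subtype.ext e)) ?_
    rw [← ha, Int.cast_zero]
  have hle : (p : ℤ) ^ k ≤ |a| := Int.le_of_dvd (abs_pos.2 ha0) ((dvd_abs _ _).2 hdvd)
  rw [D.abs_prod_twistedHom y ha.symm]
  gcongr
  exact_mod_cast hle

theorem minProductDistance_eq (D : CyclicData p r n q ℓ ζ σ) {k : ℕ} (hk : n + 1 = 2 * k)
    {y : fixedK σ n} (hy : y ∈ moduleM σ n (xElt σ n p r ℓ ζ)) (hy0 : y ≠ 0)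
    (h : orbitProd σ n (y : L) = (p : L) ^ k ∨ orbitProd σ n (y : L) = -(p : L) ^ k) :
    minProductDistance (rotatedLattice σ n p (xElt σ n p r ℓ ζ)) =
      (p : ℝ) ^ ((1 - (n : ℝ)) / 2) := by
  have hp : (0 : ℝ) < p := Nat.cast_pos.2 D.prime.pos
  have hexp : (p : ℝ) ^ ((1 - (n : ℝ)) / 2) = (p : ℝ) ^ k / (p : ℝ) ^ n := by
    have hk' : (n : ℝ) + 1 = 2 * k := by exact_mod_cast hk
    rw [← Real.rpow_natCast, ← Real.rpow_natCast, ← Real.rpow_sub hp]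
    congr 1
    linarith
  have habs : |∏ τ, twistedHom (fixedK σ n) (1 / (p : fixedK σ n) ^ 2) y τ| =
      (p : ℝ) ^ k / (p : ℝ) ^ n := by
    rcases h with h | h
    · rw [D.abs_prod_twistedHom y (a := (p : ℤ) ^ k) (by rw [h]; simp)]
      simp
    · rw [D.abs_prod_twistedHom y (a := -(p : ℤ) ^ k) (by rw [h]; simp)]
      simp
  rw [hexp]
  refine IsLeast.csInf_eq ⟨⟨_, ⟨y, hy, rfl⟩, fun e => hy0 ?_, habs.symm⟩, ?_⟩
  · exact D.twistedHom_injective (e.trans (map_zero _).symm)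
  · rintro _ ⟨_, ⟨w, hw, rfl⟩, hw0, rfl⟩
    refine D.le_abs_prod_twistedHom hk hw ?_
    rintro rfl
    exact hw0 (map_zero _)

end CyclicData

/-- For odd `n > 1` the prime `p` is odd, so `(p - 1) / n` is even. This evenness makes `K` real and
cancels the alternating signs. -/
theorem exists_cyclicData {p r n : ℕ} {ℓ : ℤ} {ζ : L} {σ : L ≃ₐ[ℚ] L} (hn : Odd n)
    (hn1 : 1 < n) (hp : p.Prime) (hpn : p ≡ 1 [MOD n]) (hζ : IsPrimitiveRoot ζ p)
    (hr : orderOf (r : ZMod p) = p - 1) (hℓ : ℓ * ((r : ℤ) - 1) ≡ 1 [ZMOD (p : ℤ)])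
    (hσ : σ ζ = ζ ^ r) : ∃ q, CyclicData p r n q ℓ ζ σ := by
  obtain ⟨m, hm⟩ := (Nat.modEq_iff_dvd' hp.one_lt.le).1 hpn.symm
  have hp2 : p ≠ 2 := by
    rintro rfl
    have := Nat.le_of_dvd one_pos ⟨m, hm⟩
    omega
  have heven : Even (n * m) := by
    rw [← hm]
    exact hp.even_sub_one hp2
  obtain ⟨q, rfl⟩ := even_iff_two_dvd.1
    ((Nat.even_mul.1 heven).resolve_left (Nat.not_even_iff_odd.2 hn))
  exact ⟨q, hp, hζ, hr, hσ, hn, hm, hℓ⟩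

namespace CyclicData

variable {p r n q : ℕ} {ℓ : ℤ} {ζ : L} {σ : L ≃ₐ[ℚ] L} [IsCyclotomicExtension {p} ℚ L]

/-- A unit has norm `± 1`, so `y` has the norm of `x` up to sign, which meets the lower bound. -/
theorem minProductDistance_of_unit (D : CyclicData p r n q ℓ ζ σ) {y e : fixedK σ n}
    (hu : IsIntegral ℤ (σ (xElt σ n p r ℓ ζ : fixedK σ n) / (xElt σ n p r ℓ ζ : fixedK σ n)))
    (hy : y ∈ moduleM σ n (xElt σ n p r ℓ ζ)) (hye : y = xElt σ n p r ℓ ζ * e)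
    (he : ∃ v : (𝓞 (fixedK σ n))ˣ, ((v : 𝓞 (fixedK σ n)) : fixedK σ n) = e) :
    minProductDistance (rotatedLattice σ n p (xElt σ n p r ℓ ζ)) =
      (p : ℝ) ^ ((1 - (n : ℝ)) / 2) := by
  obtain ⟨v, rfl⟩ := he
  obtain ⟨k, hk⟩ : ∃ k, n + 1 = 2 * k := by
    obtain ⟨j, hj⟩ := D.odd
    exact ⟨j + 1, by omega⟩
  have hint : ∀ w : 𝓞 (fixedK σ n), IsIntegral ℤ (((w : fixedK σ n)) : L) := fun w =>
    (NumberField.RingOfIntegers.isIntegral_coe w).map ((fixedK σ n).val.restrictScalars ℤ)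
  set e : L := ((((v : 𝓞 (fixedK σ n)) : fixedK σ n)) : L) with he
  set e' : L := (((((v⁻¹ : (𝓞 (fixedK σ n))ˣ) : 𝓞 (fixedK σ n)) : fixedK σ n)) : L) with he'
  have hmul : e * e' = 1 := by
    have h1 : (((v : 𝓞 (fixedK σ n)) : fixedK σ n)) *
        ((((v⁻¹ : (𝓞 (fixedK σ n))ˣ) : 𝓞 (fixedK σ n)) : fixedK σ n)) = 1 := by
      rw [← map_mul, Units.mul_inv, map_one]
    exact congrArg (fun t : fixedK σ n => (t : L)) h1
  have hyL : (y : L) = (xElt σ n p r ℓ ζ : fixedK σ n) * e := by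
    rw [hye, MulMemClass.coe_mul]
  have hy0 : y ≠ 0 := by
    intro h
    have : (xElt σ n p r ℓ ζ : fixedK σ n) * e = 0 := by
      rw [← hyL, h]
      rfl
    rcases mul_eq_zero.1 this with h | h
    · exact D.xElt_ne_zero h
    · rw [h, zero_mul] at hmul
      exact zero_ne_one hmul
  have hunit := D.orbitProd_unit (sigma_pow_coe _) (sigma_pow_coe _) (hint _) (hint _) hmul
  have hx := D.orbitProd_xElt hk (fun w v => D.exists_eq_sum_conj) hu
  refine D.minProductDistance_eq hk hy hy0 ?_
  rw [hyL, orbitProd_mul]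
  rcases hunit with h | h <;> rcases hx with h' | h' <;> rw [h, h'] <;> simp

end CyclicData

end ProductDistance

end RotatedDn

theorem mainTheorem7 {L : Type*} [Field L] [NumberField L]
    (n p r : ℕ) (ℓ : ℤ) (hn : Odd n) (hn1 : 1 < n)
    (hp : p.Prime) (hpn : p ≡ 1 [MOD n])
    [IsCyclotomicExtension {p} ℚ L] (ζ : L) (hζ : IsPrimitiveRoot ζ p)
    (hr : orderOf (r : ZMod p) = p - 1)
    (hℓ : ℓ * ((r : ℤ) - 1) ≡ 1 [ZMOD (p : ℤ)])
    (σ : L ≃ₐ[ℚ] L) (hσ : σ ζ = ζ ^ r)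
    (x u : RotatedDn.fixedK σ n)
    (hx : x = RotatedDn.xElt σ n p r ℓ ζ)
    (hu : u = RotatedDn.sigmaK σ n x / x)
    (hu_int : (u : L) ∈ Algebra.adjoin ℤ {ζ})
    (hunit : (∃ v : (𝓞 (RotatedDn.fixedK σ n))ˣ, ((v : 𝓞 (RotatedDn.fixedK σ n)) :
          RotatedDn.fixedK σ n) = 1 + u) ∨
      (∃ v : (𝓞 (RotatedDn.fixedK σ n))ˣ, ((v : 𝓞 (RotatedDn.fixedK σ n)) :
          RotatedDn.fixedK σ n) = 1 - u)) :
    RotatedDn.IsRotatedVersion (RotatedDn.rotatedLattice σ n p x) (RotatedDn.latticeD n) ∧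
    RotatedDn.HasMaximumDiversity (RotatedDn.rotatedLattice σ n p x) ∧
    RotatedDn.minProductDistance (RotatedDn.rotatedLattice σ n p x) =
      (p : ℝ) ^ ((1 - (n : ℝ)) / 2) := by
  obtain ⟨q, D⟩ := RotatedDn.exists_cyclicData hn hn1 hp hpn hζ hr hℓ hσ
  subst hx hu
  set x := RotatedDn.xElt σ n p r ℓ ζ with hx
  have hx0 : x ≠ 0 := fun h => D.xElt_ne_zero (congrArg (fun t : RotatedDn.fixedK σ n => (t : L)) h)
  -- `ℤ[ζ]` is finitely generated over `ℤ`, so its elements are integral.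
  have hu : IsIntegral ℤ (σ (x : L) / (x : L)) :=
    IsIntegral.of_mem_of_fg _ (IsIntegral.fg_adjoin_singleton D.isIntegral_zeta) _ hu_int
  refine ⟨D.isRotatedVersion hn1, D.hasMaximumDiversity x, ?_⟩
  -- In both cases `x (1 ± u) = x ± σ x` is one of the generators of `M`.
  rcases hunit with h | h
  · refine D.minProductDistance_of_unit (y := x + RotatedDn.sigmaK σ n x) hu
      (AddSubgroup.subset_closure (Or.inl rfl)) ?_ h
    rw [mul_add, mul_one, mul_div_cancel₀ _ hx0]
  · refine D.minProductDistance_of_unit (y := x - RotatedDn.sigmaK σ n x) hu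
      (AddSubgroup.subset_closure (Or.inr ⟨0, by omega, by simp [hx]⟩)) ?_ h
    rw [mul_sub, mul_one, mul_div_cancel₀ _ hx0]
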